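/- Let $\mathbb T^2=\mathbb R^2/\mathbb Z^2$, $K\ge 2$, $\alpha\in(0,1)$, $\beta>0$, $c_1,\dots,c_K\in\mathbb R$, let $\varphi_1^{\rm in},\dots,\varphi_K^{\rm in}\in C^{1,\alpha}(\mathbb T^2)$, and put $$\omega_0^\beta(x)=\sum_{k=1}^K c_k\,\frac{e^{\beta\varphi_k^{\rm in}(x)}}{\sum_{j=1}^K e^{\beta\varphi_j^{\rm in}(x)}} .$$ Let $I=[0,T]$ with $0<T<\infty$, or $I=[0,\infty)$. Let $(\omega^\beta,u^\beta)$ be a Yudovich solution on $I$ (a weak solution with vorticity bounded on compact subintervals of $I$) of the Euler equation $$\partial_t\omega+u\cdot\nabla\omega=0,\qquad u=\nabla^\perp\psi,\qquad -\Delta\psi=\omega-\langle\omega\rangle ,$$ with initial vorticity $\omega_0^\beta$, where $\langle\omega\rangle$ is the spatial mean and $\nabla^\perp=(\partial_2,-\partial_1)$. For $k=1,\dots,K$ let $\varphi_k^\beta$ be a weak solution on $I$, bounded on compact subintervals of $I$, of the transport equation with the common velocity $u^\beta$, $$\partial_t\varphi_k^\beta+u^\beta\cdot\nabla\varphi_k^\beta=0,\qquad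 \varphi_k^\beta|_{t=0}=\varphi_k^{\rm in}.$$ Here a weak solution $f$ of $\partial_t f+u\cdot\nabla f=0$, $f|_{t=0}=f_0$ (with $\operatorname{div}u=0$) satisfies, for every $t\in I$ and every $\eta\in C^\infty(\mathbb R\times\mathbb T^2)$, $$\int_{\mathbb T^2} f(t)\,\eta(t)\,dx=\int_{\mathbb T^2} f_0\,\eta(0)\,dx+\int_0^t\!\!\int_{\mathbb T^2} f\,(\partial_t\eta+u\cdot\nabla\eta)\,dx\,ds ,$$ and the relations between $u$, $\psi$ and $\omega$ hold in the sense of distributions at every time $t \in I$, with $u$ integrable on $[0,\tau]\times\mathbb T^2$ for every $\tau\in I$. Then for every $t\in I$ $$\omega^\beta(t,x)=\sum_{k=1}^K c_k\,\pi_k^\beta(t,x),\qquad \pi_k^\beta(t,x)=\frac{e^{\beta\varphi_k^\beta(t,x)}}{\sum_{j=1}^K e^{\beta\varphi_j^\beta(t,x)}},$$ for almost every $x\in\mathbb T^2$, and for every $x\in\mathbb T^2$ if $\omega^\beta(t,\cdot)$ and all $\varphi_k^\beta(t,\cdot)$ are (represented by) continuous functions. -/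

import Mathlib

namespace SoftmaxEuler

open MeasureTheory

noncomputable section

/-- The two-dimensional torus `ℝ² / ℤ²`, with its Lebesgue measure `volume` (of total mass one). -/
abbrev Torus : Type := UnitAddTorus (Fin 2)

/-- The covering map `ℝ² → 𝕋²`. -/
def proj (y : Fin 2 → ℝ) : Torus := fun i => (y i : UnitAddCircle)

/-- The classical partial derivative `∂ᵢ f (x)` of a function on the torus. -/
def partialDeriv (i : Fin 2) (f : Torus → ℝ) (x : Torus) : ℝ :=
  deriv (fun s : ℝ => f (x + proj (Pi.single i s))) 0

/-- The Laplacian of a function on the torus. -/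
def laplacian (f : Torus → ℝ) (x : Torus) : ℝ :=
  ∑ i : Fin 2, partialDeriv i (partialDeriv i f) x

/-- `f ∈ C^{1,α}(𝕋²)`. -/
def IsC1Holder (α : ℝ) (f : Torus → ℝ) : Prop :=
  ContDiff ℝ 1 (fun y : Fin 2 → ℝ => f (proj y)) ∧
    ∀ i : Fin 2, ∃ C : ℝ, ∀ x y : Torus,
      |partialDeriv i f x - partialDeriv i f y| ≤ C * dist x y ^ α

/-- `η ∈ C^∞(𝕋²)`. -/
def IsSmooth (η : Torus → ℝ) : Prop :=
  ContDiff ℝ (⊤ : ℕ∞) (fun y : Fin 2 → ℝ => η (proj y))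

/-- `η ∈ C^∞(ℝ × 𝕋²)`: a smooth, time-dependent function on the torus. -/
def IsSmoothInTime (η : ℝ → Torus → ℝ) : Prop :=
  ContDiff ℝ (⊤ : ℕ∞) (fun p : ℝ × (Fin 2 → ℝ) => η p.1 (proj p.2))

/-- `g = ∂ᵢ f` in the sense of distributions, for integrable `f` and `g`. -/
def HasWeakPartial (i : Fin 2) (f g : Torus → ℝ) : Prop :=
  Integrable f ∧ Integrable g ∧
    ∀ η : Torus → ℝ, IsSmooth η → ∫ x, g x * η x = - ∫ x, f x * partialDeriv i η x

/-- `v` is the velocity field of the vorticity `w`: for some stream function `ψ`,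
`v = ∇^⊥ ψ = (∂₂ψ, -∂₁ψ)` and `-Δψ = w - ⟨w⟩`, in the sense of distributions
(so that `∂₁v₂ - ∂₂v₁ = w - ⟨w⟩`; the coordinates of `Fin 2` are numbered `0, 1`). -/
def IsVelocityOf (w : Torus → ℝ) (v : Torus → Fin 2 → ℝ) : Prop :=
  ∃ ψ : Torus → ℝ,
    HasWeakPartial 1 ψ (fun x => v x 0) ∧
    HasWeakPartial 0 ψ (fun x => - v x 1) ∧
    ∀ η : Torus → ℝ, IsSmooth η →
      ∫ x, ψ x * (- laplacian η x) = ∫ x, (w x - ⨍ z, w z) * η x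

/-- The times of the interval `[0, T]`, to be read as `[0, ∞)` if `T = ⊤`. -/
def times (T : EReal) : Set ℝ := {t | 0 ≤ t ∧ (t : EReal) ≤ T}

/-- `f ∈ L^∞_loc(times T; L^∞(𝕋²))`, given as a family of functions on the torus. -/
def IsLocallyBounded (T : EReal) (f : ℝ → Torus → ℝ) : Prop :=
  (∀ t ∈ times T, AEStronglyMeasurable (f t) volume) ∧
  ∀ τ ∈ times T,
    AEStronglyMeasurable (fun p : ℝ × Torus => f p.1 p.2)
      ((volume.restrict (Set.Icc 0 τ)).prod volume) ∧
    ∃ M : ℝ, ∀ t ∈ Set.Icc 0 τ, ∀ᵐ x : Torus, |f t x| ≤ M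

/-- `f` is a bounded weak solution on `times T` of the transport equation
`∂ₜ f + u · ∇ f = 0`, `f(0, ·) = f₀`, for a divergence-free velocity field `u`. -/
def IsTransported (T : EReal) (u : ℝ → Torus → Fin 2 → ℝ) (f₀ : Torus → ℝ)
    (f : ℝ → Torus → ℝ) : Prop :=
  IsLocallyBounded T f ∧
  ∀ η : ℝ → Torus → ℝ, IsSmoothInTime η → ∀ t ∈ times T,
    ∫ x, f t x * η t x = (∫ x, f₀ x * η 0 x) +
      ∫ s in (0 : ℝ)..t, ∫ x, f s x *
        (deriv (fun r => η r x) s + ∑ i : Fin 2, u s x i * partialDeriv i (η s) x)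

/-- `(ω, u)` is a weak solution in the Yudovich class (bounded vorticity) on `times T` of the
Euler equation `∂ₜ ω + u · ∇ ω = 0`, `u = ∇^⊥ ψ`, `-Δψ = ω - ⟨ω⟩`, with `ω(0, ·) = ω₀`. -/
structure IsYudovichSolution (T : EReal) (ω₀ : Torus → ℝ) (ω : ℝ → Torus → ℝ)
    (u : ℝ → Torus → Fin 2 → ℝ) : Prop where
  velocity_integrable : ∀ τ ∈ times T, ∀ i : Fin 2,
    Integrable (fun p : ℝ × Torus => u p.1 p.2 i) ((volume.restrict (Set.Icc 0 τ)).prod volume)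
  velocity : ∀ t ∈ times T, IsVelocityOf (ω t) (u t)
  transport : IsTransported T u ω₀ ω

/-- The softmax weight `exp (β aₖ) / ∑ⱼ exp (β aⱼ)`. -/
def softmaxWeight {K : ℕ} (β : ℝ) (a : Fin K → ℝ) (k : Fin K) : ℝ :=
  Real.exp (β * a k) / ∑ j : Fin K, Real.exp (β * a j)

/-- The mixture `∑ₖ cₖ πₖ^β(x)` of the levels `cₖ` with the softmax weights
`πₖ^β(x) = exp (β φₖ(x)) / ∑ⱼ exp (β φⱼ(x))` of the markers `φₖ`. -/
def softmaxMixture {K : ℕ} (β : ℝ) (c : Fin K → ℝ) (φ : Fin K → Torus → ℝ) (x : Torus) : ℝ :=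
  ∑ k : Fin K, c k * softmaxWeight β (fun j => φ j x) k

end

end SoftmaxEuler

namespace SoftmaxEuler

open MeasureTheory

/-! ### Smooth functions on the torus -/

/-! The vorticity and the markers are all transported by one divergence-free field. If they were
constant along a smooth flow, so would be any function of them. Here everything is weak, so the
argument is DiPerna–Lions renormalization, done jointly for the `K + 1` scalars: for smooth `G` of
several variables, `∫ G(f₁, …, fₘ)` is conserved (`integral_comp_eq_of_isTransported`). With `G =
softmaxDefect`, the squared difference between the vorticity and the mixture of the markers, the
integral is zero at time zero, hence always, and `G ≥ 0` makes the defect vanish almost everywhere.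
Neither a flow nor uniqueness for the Euler equation enters.

The field is regular enough because the vorticity is bounded. On the Fourier side `|k| |û(k)| ≤
|ŵ(k)|`, so the velocity lies in `H¹` with a bound uniform on compact time intervals
(`IsVelocityOf.isSobolevField`). This is used as a bound on the `L²` norm of translation
differences.

Conservation is obtained by mollifying in space. The mollified scalars satisfy `∂ₜ fₙ + v · ∇fₙ =
rₙ`, where `rₙ(x)` is the integral over `z` of `(f(x - z) - f(x)) (v(x) - v(x - z)) · ∇ρₙ(z)`
(`commutator_eq`). Factoring `(∂ⱼρₙ)²` as `(n + 1) ρₙ · σₙ` and applying the weighted inequality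
`2ab ≤ c a² + b² / c` separates the two differences: the velocity part is at most a constant times
`c` by the `H¹` bound, and the other part tends to zero for fixed `c` by continuity of translations
in `L²`. So `rₙ → 0` in `L¹` (`tendsto_integral_abs_commutator`), and dominated convergence in time
finishes the proof.

The mollifiers are products of normalized powers of `cos² πz`. Their moments follow from the Wallis
recursion, and `ρₙ(x - y)` is a finite sum of products `a(x) b(y)`. Mollification is thus a
finite-rank operator, which settles smoothness in space and measurability in time without
differentiating under an integral. -/

lemma proj_add (y z : Fin 2 → ℝ) : proj (y + z) = proj y + proj z := by
  ext i; simp [proj]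

lemma proj_zero : proj 0 = 0 := by
  ext i; simp [proj]

lemma proj_sub (y z : Fin 2 → ℝ) : proj (y - z) = proj y - proj z := by
  ext i; simp [proj]

/-- Lets continuity and pointwise identities on the torus be checked on the periodic lift to the
plane. -/
lemma isOpenQuotientMap_proj : IsOpenQuotientMap proj :=
  IsOpenQuotientMap.piMap (f := fun _ : Fin 2 => ((↑) : ℝ → UnitAddCircle))
    fun _ => QuotientAddGroup.isOpenQuotientMap_mk

lemma proj_surjective : Function.Surjective proj := isOpenQuotientMap_proj.surjective

lemma continuous_of_comp_proj {f : Torus → ℝ} (h : Continuous fun y => f (proj y)) :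
    Continuous f :=
  isOpenQuotientMap_proj.isQuotientMap.continuous_iff.2 h

lemma IsSmooth.continuous {η : Torus → ℝ} (h : IsSmooth η) : Continuous η :=
  continuous_of_comp_proj (ContDiff.continuous h)

lemma isSmooth_const (c : ℝ) : IsSmooth fun _ => c := contDiff_const

lemma IsSmooth.add {f g : Torus → ℝ} (hf : IsSmooth f) (hg : IsSmooth g) :
    IsSmooth fun x => f x + g x := ContDiff.add hf hg

lemma IsSmooth.mul {f g : Torus → ℝ} (hf : IsSmooth f) (hg : IsSmooth g) :
    IsSmooth fun x => f x * g x := ContDiff.mul hf hg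

lemma IsSmooth.sum {ι : Type*} {s : Finset ι} {f : ι → Torus → ℝ}
    (hf : ∀ i ∈ s, IsSmooth (f i)) : IsSmooth fun x => ∑ i ∈ s, f i x :=
  ContDiff.sum hf

lemma IsSmooth.comp_contDiff {ι : Type*} [Fintype ι] {G : (ι → ℝ) → ℝ}
    (hG : ContDiff ℝ (⊤ : ℕ∞) G)
    {F : ι → Torus → ℝ} (hF : ∀ i, IsSmooth (F i)) : IsSmooth fun x => G fun i => F i x :=
  hG.comp (contDiff_pi.2 hF)

lemma IsSmooth.comp_sub_left {η : Torus → ℝ} (h : IsSmooth η) (x : Torus) :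
    IsSmooth fun y => η (x - y) := by
  obtain ⟨x', rfl⟩ := proj_surjective x
  have : ContDiff ℝ (⊤ : ℕ∞) fun y : Fin 2 → ℝ => η (proj (x' - y)) :=
    ContDiff.comp (g := fun y => η (proj y)) h (contDiff_const.sub contDiff_id)
  simpa only [IsSmooth, proj_sub] using this

lemma IsSmooth.isSmoothInTime {η : Torus → ℝ} (h : IsSmooth η) :
    IsSmoothInTime fun _ => η :=
  ContDiff.comp (g := fun y => η (proj y)) h contDiff_snd

lemma hasDerivAt_comp_proj {η : Torus → ℝ} (i : Fin 2) (y : Fin 2 → ℝ)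
    (h : DifferentiableAt ℝ (fun y => η (proj y)) y) :
    HasDerivAt (fun s : ℝ => η (proj y + proj (Pi.single i s)))
      (fderiv ℝ (fun y => η (proj y)) y (Pi.single i 1)) 0 := by
  have h1 : HasDerivAt (fun s : ℝ => y + (Pi.single i s : Fin 2 → ℝ)) (Pi.single i 1) 0 := by
    have := (ContinuousLinearMap.single ℝ (fun _ : Fin 2 => ℝ) i).hasDerivAt (x := 0)
    exact HasDerivAt.const_add y this
  have h2 : HasFDerivAt (fun y => η (proj y)) (fderiv ℝ (fun y => η (proj y)) y)
      (y + (Pi.single i (0 : ℝ) : Fin 2 → ℝ)) := by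
    simpa using h.hasFDerivAt
  simpa only [Function.comp_def, proj_add] using h2.comp_hasDerivAt 0 h1

lemma IsSmooth.partialDeriv_proj {η : Torus → ℝ} (h : IsSmooth η) (i : Fin 2) (y : Fin 2 → ℝ) :
    partialDeriv i η (proj y) = fderiv ℝ (fun y => η (proj y)) y (Pi.single i 1) :=
  (hasDerivAt_comp_proj i y ((ContDiff.differentiable h (by simp)) y)).deriv

lemma IsSmooth.hasDerivAt {η : Torus → ℝ} (h : IsSmooth η) (i : Fin 2) (x : Torus) :
    HasDerivAt (fun s : ℝ => η (x + proj (Pi.single i s))) (partialDeriv i η x) 0 := by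
  obtain ⟨y, rfl⟩ := proj_surjective x
  rw [h.partialDeriv_proj]
  exact hasDerivAt_comp_proj i y ((ContDiff.differentiable h (by simp)) y)

lemma IsSmooth.partialDeriv {η : Torus → ℝ} (h : IsSmooth η) (i : Fin 2) :
    IsSmooth (partialDeriv i η) := by
  have h1 : ContDiff ℝ (⊤ : ℕ∞) fun y => fderiv ℝ (fun y => η (proj y)) y (Pi.single i 1) :=
    (ContDiff.fderiv_right h (by simp)).clm_apply contDiff_const
  simpa only [IsSmooth, h.partialDeriv_proj] using h1

/-- Symmetry of the second derivative of the lift; it is what makes `∇^⊥ψ` weakly divergence free.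
-/
lemma IsSmooth.partialDeriv_comm {η : Torus → ℝ} (h : IsSmooth η) (i j : Fin 2) (x : Torus) :
    SoftmaxEuler.partialDeriv i (SoftmaxEuler.partialDeriv j η) x =
      SoftmaxEuler.partialDeriv j (SoftmaxEuler.partialDeriv i η) x := by
  obtain ⟨y, rfl⟩ := proj_surjective x
  have key : ∀ i j : Fin 2, SoftmaxEuler.partialDeriv i (SoftmaxEuler.partialDeriv j η) (proj y) =
      fderiv ℝ (fderiv ℝ (fun y => η (proj y))) y (Pi.single i 1) (Pi.single j 1) := by
    intro i j
    rw [(h.partialDeriv j).partialDeriv_proj]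
    simp only [h.partialDeriv_proj]
    have hd : DifferentiableAt ℝ (fderiv ℝ (fun y => η (proj y))) y :=
      (ContDiff.differentiable (n := 1) (ContDiff.fderiv_right h (by norm_cast)) (by simp)) y
    rw [fderiv_clm_apply hd (differentiableAt_const _)]
    simp
  rw [key, key]
  have hs : IsSymmSndFDerivAt ℝ (fun y => η (proj y)) y :=
    (ContDiff.contDiffAt h).isSymmSndFDerivAt (by
      simpa using WithTop.coe_le_coe.2 (le_top : (2 : ℕ∞) ≤ ⊤))
  exact hs.eq _ _

lemma IsSmooth.partialDeriv_comp_sub_left {η : Torus → ℝ} (h : IsSmooth η) (i : Fin 2)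
    (x y : Torus) :
    SoftmaxEuler.partialDeriv i (fun y => η (x - y)) y =
      -SoftmaxEuler.partialDeriv i η (x - y) := by
  have h1 := h.hasDerivAt i (x - y)
  have h2 : HasDerivAt (fun s : ℝ => -s) (-1) 0 := hasDerivAt_neg 0
  have h3 := HasDerivAt.comp (h₂ := fun s : ℝ => η ((x - y) + proj (Pi.single i s))) (0 : ℝ)
    (by simpa using h1) h2
  refine (HasDerivAt.deriv (f' := -SoftmaxEuler.partialDeriv i η (x - y)) ?_)
  convert! h3 using 1
  · ext s
    simp only [Function.comp]
    have : proj (Pi.single i (-s)) = - proj (Pi.single i s) := by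
      rw [Pi.single_neg, ← zero_sub, proj_sub, proj_zero, zero_sub]
    rw [this]; congr 1; abel
  · ring

lemma IsSmooth.partialDeriv_comp {ι : Type*} [Fintype ι] {G : (ι → ℝ) → ℝ}
    (hG : ContDiff ℝ (⊤ : ℕ∞) G) {F : ι → Torus → ℝ} (hF : ∀ i, IsSmooth (F i)) (j : Fin 2)
    (x : Torus) :
    SoftmaxEuler.partialDeriv j (fun x => G fun i => F i x) x =
      fderiv ℝ G (fun i => F i x) (fun i => SoftmaxEuler.partialDeriv j (F i) x) := by
  have h1 : HasDerivAt (fun s : ℝ => fun i => F i (x + proj (Pi.single j s)))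
      (fun i => SoftmaxEuler.partialDeriv j (F i) x) 0 :=
    hasDerivAt_pi.2 fun i => (hF i).hasDerivAt j x
  have h2 : HasFDerivAt G (fderiv ℝ G (fun i => F i x))
      (fun i => F i (x + proj (Pi.single j (0 : ℝ)))) := by
    simpa [proj_zero] using (hG.differentiable (by simp) _).hasFDerivAt
  exact (h2.comp_hasDerivAt 0 h1).deriv

lemma IsSmooth.partialDeriv_sum_mul {κ : Type*} [Fintype κ] {a : κ → Torus → ℝ}
    (ha : ∀ l, IsSmooth (a l)) (c : κ → ℝ) (j : Fin 2) (x : Torus) :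
    SoftmaxEuler.partialDeriv j (fun x => ∑ l, a l x * c l) x =
      ∑ l, SoftmaxEuler.partialDeriv j (a l) x * c l :=
  (HasDerivAt.fun_sum fun l _ => ((ha l).hasDerivAt j x).mul_const (c l)).deriv

end SoftmaxEuler

namespace SoftmaxEuler

open MeasureTheory

/-! ### Measures on the circle and the torus -/

instance : IsProbabilityMeasure (volume : Measure UnitAddCircle) :=
  ⟨by simp⟩

instance : IsProbabilityMeasure (volume : Measure Torus) :=
  inferInstanceAs (IsProbabilityMeasure
    (Measure.pi fun _ : Fin 2 => (volume : Measure UnitAddCircle)))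

instance : Measure.Regular (volume : Measure Torus) := inferInstance
instance : Measure.IsNegInvariant (volume : Measure Torus) :=
  Measure.IsAddHaarMeasure.isNegInvariant_of_regular _

lemma Torus.integrable_of_continuous {f : Torus → ℝ} (hf : Continuous f) : Integrable f :=
  hf.integrable_of_hasCompactSupport (HasCompactSupport.of_compactSpace f)

/-! ### The kernels -/

noncomputable section

/-- The function `(1 + cos 2πz) / 2` on the circle. -/
def bumpCos (z : UnitAddCircle) : ℝ := (1 + (fourier 1 z).re) / 2

/-- The function `sin 2πz` on the circle. -/
def bumpSin (z : UnitAddCircle) : ℝ := (fourier 1 z).im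

lemma fourier_one_coe (r : ℝ) :
    (fourier 1 (r : UnitAddCircle) : ℂ) = Complex.exp ((2 * Real.pi * r : ℝ) * Complex.I) := by
  rw [fourier_coe_apply]
  congr 1; push_cast; ring

lemma bumpCos_coe (r : ℝ) : bumpCos r = (1 + Real.cos (2 * Real.pi * r)) / 2 := by
  rw [bumpCos, fourier_one_coe, Complex.exp_ofReal_mul_I_re]

lemma bumpSin_coe (r : ℝ) : bumpSin r = Real.sin (2 * Real.pi * r) := by
  rw [bumpSin, fourier_one_coe, Complex.exp_ofReal_mul_I_im]

lemma continuous_bumpCos : Continuous bumpCos := by unfold bumpCos; fun_prop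

lemma continuous_bumpSin : Continuous bumpSin := by unfold bumpSin; fun_prop

lemma bumpCos_nonneg (z : UnitAddCircle) : 0 ≤ bumpCos z := by
  induction z using QuotientAddGroup.induction_on with
  | H r => rw [bumpCos_coe]; linarith [Real.neg_one_le_cos (2 * Real.pi * r)]

lemma bumpCos_le_one (z : UnitAddCircle) : bumpCos z ≤ 1 := by
  induction z using QuotientAddGroup.induction_on with
  | H r => rw [bumpCos_coe]; linarith [Real.cos_le_one (2 * Real.pi * r)]

lemma bumpSin_sq (z : UnitAddCircle) : bumpSin z ^ 2 = 4 * bumpCos z * (1 - bumpCos z) := by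
  induction z using QuotientAddGroup.induction_on with
  | H r =>
    rw [bumpCos_coe, bumpSin_coe]
    linarith [Real.sin_sq_add_cos_sq (2 * Real.pi * r)]

/-- The addition formula for `cos 2π(x - y)`, with `cos 2πx` written as `2 * bumpCos x - 1`. It
separates the variables in the kernels. -/
lemma bumpCos_sub (x y : UnitAddCircle) :
    bumpCos (x - y) =
      (1 + (2 * bumpCos x - 1) * (2 * bumpCos y - 1) + bumpSin x * bumpSin y) / 2 := by
  induction x using QuotientAddGroup.induction_on with
  | H r =>
  induction y using QuotientAddGroup.induction_on with
  | H s =>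
    rw [← QuotientAddGroup.mk_sub]
    simp only [bumpCos_coe, bumpSin_coe, mul_sub, Real.cos_sub]
    ring

lemma bumpCos_neg (x : UnitAddCircle) : bumpCos (-x) = bumpCos x := by
  induction x using QuotientAddGroup.induction_on with
  | H r =>
    rw [← QuotientAddGroup.mk_neg, bumpCos_coe, bumpCos_coe, mul_neg, Real.cos_neg]

lemma bumpSin_neg (x : UnitAddCircle) : bumpSin (-x) = -bumpSin x := by
  induction x using QuotientAddGroup.induction_on with
  | H r =>
    rw [← QuotientAddGroup.mk_neg, bumpSin_coe, bumpSin_coe, mul_neg, Real.sin_neg]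

lemma norm_fourier_one_sub_one_sq (z : UnitAddCircle) :
    ‖(fourier 1 z : ℂ) - 1‖ ^ 2 = 4 * (1 - bumpCos z) := by
  have h : ‖(fourier 1 z : ℂ)‖ = 1 := Circle.norm_coe _
  have h2 : (fourier 1 z : ℂ).re ^ 2 + (fourier 1 z : ℂ).im ^ 2 = 1 := by
    have := Complex.sq_norm (fourier 1 z : ℂ)
    rw [h, Complex.normSq_apply] at this
    nlinarith
  rw [Complex.sq_norm, Complex.normSq_apply, bumpCos]
  simp only [Complex.sub_re, Complex.one_re, Complex.sub_im, Complex.one_im]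
  nlinarith

/-- The moments of `bumpCos`. -/
def bumpMoment (n : ℕ) : ℝ := ∫ z, bumpCos z ^ n

lemma bumpMoment_eq (n : ℕ) :
    bumpMoment n = Real.pi⁻¹ * ∫ x in (0 : ℝ)..Real.pi, Real.cos x ^ (2 * n) := by
  rw [bumpMoment, ← UnitAddCircle.intervalIntegral_preimage 0]
  have h : ∀ a : ℝ, bumpCos (a : UnitAddCircle) ^ n = Real.cos (Real.pi * a) ^ (2 * n) := by
    intro a
    rw [bumpCos_coe, pow_mul, Real.cos_sq]
    congr 1
    ring_nf
  simp_rw [h]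
  rw [intervalIntegral.integral_comp_mul_left (fun x => Real.cos x ^ (2 * n)) Real.pi_ne_zero]
  simp

lemma bumpMoment_zero : bumpMoment 0 = 1 := by simp [bumpMoment]

/-- The Wallis recursion for the integrals of even powers of the cosine; the boundary terms vanish
at `0` and `π`. -/
lemma bumpMoment_succ (n : ℕ) :
    (2 * n + 2) * bumpMoment (n + 1) = (2 * n + 1) * bumpMoment n := by
  rw [bumpMoment_eq, bumpMoment_eq, mul_add, integral_cos_pow]
  simp only [Real.sin_pi, Real.sin_zero]
  push_cast
  field_simp
  ring

lemma bumpMoment_pos (n : ℕ) : 0 < bumpMoment n := by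
  induction n with
  | zero => rw [bumpMoment_zero]; norm_num
  | succ n ih =>
    have := bumpMoment_succ n
    have h2 : 0 < (2 * (n : ℝ) + 2) * bumpMoment (n + 1) := by rw [this]; positivity
    exact pos_of_mul_pos_right h2 (by positivity)

/-- Fubini. In `Fin 2` the index `1 - j` is the coordinate other than `j`, so one formula serves
both directions of differentiation. -/
lemma integral_bumpCos_pow_mul (m n : ℕ) (j : Fin 2) :
    ∫ z : Torus, bumpCos (z j) ^ m * bumpCos (z (1 - j)) ^ n =
      bumpMoment m * bumpMoment n := by
  have := integral_fin_nat_prod_volume_eq_prod (E := fun _ : Fin 2 => UnitAddCircle)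
    (fun i x => bumpCos x ^ (if i = j then m else n))
  simp only [Fin.prod_univ_two] at this
  fin_cases j
  · simpa [bumpMoment] using this
  · rw [mul_comm]; simpa [bumpMoment, mul_comm] using this

/-- The squared distance to the origin, up to constants. -/
def wgt (z : Torus) : ℝ := ∑ i, 4 * (1 - bumpCos (z i))

/-- The mollifiers. -/
def ker (n : ℕ) (z : Torus) : ℝ := ∏ i, bumpCos (z i) ^ (n + 1) / bumpMoment (n + 1)

/-- The partial derivatives of the mollifiers. -/
def dker (n : ℕ) (j : Fin 2) (z : Torus) : ℝ :=
  -(Real.pi * (n + 1)) * bumpSin (z j) * bumpCos (z j) ^ n * bumpCos (z (1 - j)) ^ (n + 1) /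
    bumpMoment (n + 1) ^ 2

/-- The kernels `(∂ⱼ ker)² / ((n + 1) ker)`. -/
def sker (n : ℕ) (j : Fin 2) (z : Torus) : ℝ :=
  4 * Real.pi ^ 2 * (n + 1) * (1 - bumpCos (z j)) * bumpCos (z j) ^ n *
    bumpCos (z (1 - j)) ^ (n + 1) / bumpMoment (n + 1) ^ 2

lemma continuous_wgt : Continuous wgt := by
  have := continuous_bumpCos
  unfold wgt; fun_prop

lemma continuous_ker (n : ℕ) : Continuous (ker n) := by
  have := continuous_bumpCos
  unfold ker; fun_prop

lemma continuous_dker (n : ℕ) (j : Fin 2) : Continuous (dker n j) := by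
  have := continuous_bumpCos
  have := continuous_bumpSin
  unfold dker; fun_prop

lemma continuous_sker (n : ℕ) (j : Fin 2) : Continuous (sker n j) := by
  have := continuous_bumpCos
  unfold sker; fun_prop

lemma wgt_nonneg (z : Torus) : 0 ≤ wgt z :=
  Finset.sum_nonneg fun i _ => by linarith [bumpCos_le_one (z i)]

lemma ker_nonneg (n : ℕ) (z : Torus) : 0 ≤ ker n z :=
  Finset.prod_nonneg fun _ _ => div_nonneg (pow_nonneg (bumpCos_nonneg _) _) (bumpMoment_pos _).le

lemma sker_nonneg (n : ℕ) (j : Fin 2) (z : Torus) : 0 ≤ sker n j z := by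
  have h1 := bumpCos_nonneg (z j)
  have h2 := bumpCos_nonneg (z (1 - j))
  have h3 := bumpCos_le_one (z j)
  have h4 : 0 ≤ 1 - bumpCos (z j) := by linarith
  unfold sker; positivity

lemma ker_eq (n : ℕ) (j : Fin 2) (z : Torus) :
    ker n z = bumpCos (z j) ^ (n + 1) * bumpCos (z (1 - j)) ^ (n + 1) /
      bumpMoment (n + 1) ^ 2 := by
  unfold ker
  rw [Fin.prod_univ_two]
  fin_cases j
  · simp; ring
  · simp; ring

lemma wgt_eq (j : Fin 2) (z : Torus) :
    wgt z = 4 * (1 - bumpCos (z j)) + 4 * (1 - bumpCos (z (1 - j))) := by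
  unfold wgt
  rw [Fin.sum_univ_two]
  fin_cases j
  · simp
  · simp; ring

/-- From `sin² 2πz = 4 cos² πz (1 - cos² πz)`. The quotient `(∂ⱼρₙ)² / ((n + 1) ρₙ)` is itself a
trigonometric polynomial, so there is no trouble where `ker` vanishes. This factorization drives the
commutator estimate. -/
lemma dker_sq (n : ℕ) (j : Fin 2) (z : Torus) :
    dker n j z ^ 2 = (n + 1) * ker n z * sker n j z := by
  have h := bumpSin_sq (z j)
  rw [ker_eq n j, dker, sker]
  have : (-(Real.pi * (n + 1)) * bumpSin (z j) * bumpCos (z j) ^ n *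
      bumpCos (z (1 - j)) ^ (n + 1) / bumpMoment (n + 1) ^ 2) ^ 2 =
      (Real.pi * (n + 1)) ^ 2 * bumpSin (z j) ^ 2 * (bumpCos (z j) ^ n) ^ 2 *
      (bumpCos (z (1 - j)) ^ (n + 1)) ^ 2 / (bumpMoment (n + 1) ^ 2) ^ 2 := by ring
  rw [this, h]
  ring

lemma dker_neg (n : ℕ) (j : Fin 2) (z : Torus) : dker n j (-z) = -dker n j z := by
  simp [dker, bumpCos_neg, bumpSin_neg]; ring

lemma integral_dker (n : ℕ) (j : Fin 2) : ∫ z, dker n j z = 0 := by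
  have h := integral_neg_eq_self (dker n j) volume
  simp only [dker_neg, integral_neg] at h
  linarith

lemma integral_ker (n : ℕ) : ∫ z, ker n z = 1 := by
  simp_rw [ker_eq n 0, integral_div]
  rw [integral_bumpCos_pow_mul, sq, div_self (mul_pos (bumpMoment_pos _) (bumpMoment_pos _)).ne']

lemma integrable_bumpCos_pow_mul (m n : ℕ) (j : Fin 2) :
    Integrable fun z : Torus => bumpCos (z j) ^ m * bumpCos (z (1 - j)) ^ n := by
  have := continuous_bumpCos
  exact Torus.integrable_of_continuous (by fun_prop)

/-- The second moment is `O(1/n)`: the mollifier lives at scale `n^(-1/2)`. This decay compensates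
the factor `n + 1` in `dker_sq`. -/
lemma integral_ker_mul_wgt (n : ℕ) : ∫ z, ker n z * wgt z = 8 / (2 * n + 4) := by
  have h : ∀ z, ker n z * wgt z = (8 * (bumpCos (z 0) ^ (n + 1) * bumpCos (z (1 - 0)) ^ (n + 1)) -
      4 * (bumpCos (z 0) ^ (n + 2) * bumpCos (z (1 - 0)) ^ (n + 1)) -
      4 * (bumpCos (z 0) ^ (n + 1) * bumpCos (z (1 - 0)) ^ (n + 2))) / bumpMoment (n + 1) ^ 2 := by
    intro z
    rw [ker_eq n 0, wgt_eq 0]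
    ring
  simp_rw [h]
  have i1 : ∀ (c : ℝ) (m l : ℕ), Integrable fun z : Torus =>
    c * (bumpCos (z 0) ^ m * bumpCos (z (1 - 0)) ^ l) :=
    fun c m l => (integrable_bumpCos_pow_mul m l 0).const_mul c
  rw [integral_div, integral_sub, integral_sub]
  · simp only [integral_const_mul, integral_bumpCos_pow_mul]
    have h1 := bumpMoment_succ (n + 1)
    have h2 := bumpMoment_pos (n + 1)
    push_cast at h1
    have h3 : bumpMoment (n + 2) = (2 * (n + 1) + 1) / (2 * (n + 1) + 2) * bumpMoment (n + 1) := by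
      rw [div_mul_eq_mul_div, eq_div_iff (by positivity)]; linarith
    rw [h3]
    field_simp
    ring
  · exact i1 _ _ _
  · exact i1 _ _ _
  · exact (i1 _ _ _).sub (i1 _ _ _)
  · exact i1 _ _ _

lemma integral_sker (n : ℕ) (j : Fin 2) :
    ∫ z, sker n j z = 4 * Real.pi ^ 2 * (n + 1) / (2 * n + 1) := by
  have h : ∀ z, sker n j z = 4 * Real.pi ^ 2 * (n + 1) *
      (bumpCos (z j) ^ n * bumpCos (z (1 - j)) ^ (n + 1) -
      bumpCos (z j) ^ (n + 1) * bumpCos (z (1 - j)) ^ (n + 1)) / bumpMoment (n + 1) ^ 2 := by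
    intro z
    unfold sker
    ring
  simp_rw [h]
  have i1 := integrable_bumpCos_pow_mul
  rw [integral_div, integral_const_mul, integral_sub (i1 _ _ _) (i1 _ _ _)]
  simp only [integral_bumpCos_pow_mul]
  have h1 := bumpMoment_succ n
  have h2 := bumpMoment_pos n
  have h3 : bumpMoment (n + 1) = (2 * n + 1) / (2 * n + 2) * bumpMoment n := by
    rw [div_mul_eq_mul_div, eq_div_iff (by positivity)]; linarith
  rw [h3]
  field_simp
  ring

/-- Again `O(1/n)`, whereas `integral_sker` stays bounded: `sker` behaves like an approximate
identity up to a bounded factor. -/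
lemma integral_sker_mul_wgt (n : ℕ) (j : Fin 2) :
    ∫ z, sker n j z * wgt z =
      4 * Real.pi ^ 2 * (n + 1) * (16 / ((2 * n + 1) * (2 * n + 4))) := by
  have h : ∀ z, sker n j z * wgt z = 4 * Real.pi ^ 2 * (n + 1) *
      (8 * (bumpCos (z j) ^ n * bumpCos (z (1 - j)) ^ (n + 1))
      - 12 * (bumpCos (z j) ^ (n + 1) * bumpCos (z (1 - j)) ^ (n + 1))
      + 4 * (bumpCos (z j) ^ (n + 2) * bumpCos (z (1 - j)) ^ (n + 1))
      - 4 * (bumpCos (z j) ^ n * bumpCos (z (1 - j)) ^ (n + 2))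
      + 4 * (bumpCos (z j) ^ (n + 1) * bumpCos (z (1 - j)) ^ (n + 2))) /
      bumpMoment (n + 1) ^ 2 := by
    intro z
    unfold sker
    rw [wgt_eq j]
    ring
  simp_rw [h]
  have i1 := integrable_bumpCos_pow_mul
  have i2 : ∀ (c : ℝ) (m l : ℕ), Integrable fun z : Torus =>
    c * (bumpCos (z j) ^ m * bumpCos (z (1 - j)) ^ l) := fun c m l => (i1 m l j).const_mul c
  rw [integral_div, integral_const_mul, integral_add, integral_sub, integral_add, integral_sub]
  · simp only [integral_const_mul, integral_bumpCos_pow_mul]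
    have h1 := bumpMoment_succ n
    have h2 := bumpMoment_pos n
    have h4 := bumpMoment_succ (n + 1)
    push_cast at h4
    have h3 : bumpMoment (n + 1) = (2 * n + 1) / (2 * n + 2) * bumpMoment n := by
      rw [div_mul_eq_mul_div, eq_div_iff (by positivity)]; linarith
    have h5 : bumpMoment (n + 2) = (2 * n + 3) / (2 * n + 4) * bumpMoment (n + 1) := by
      rw [div_mul_eq_mul_div, eq_div_iff (by positivity)]; linarith
    rw [h5, h3]
    field_simp
    ring
  · exact i2 _ _ _
  · exact i2 _ _ _
  · exact (i2 _ _ _).sub (i2 _ _ _)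
  · exact i2 _ _ _
  · exact ((i2 _ _ _).sub (i2 _ _ _)).add (i2 _ _ _)
  · exact i2 _ _ _
  · exact (((i2 _ _ _).sub (i2 _ _ _)).add (i2 _ _ _)).sub (i2 _ _ _)
  · exact i2 _ _ _

/-! ### Smoothness and derivatives of the kernels -/

lemma isSmooth_bumpCos (i : Fin 2) : IsSmooth fun z => bumpCos (z i) := by
  unfold IsSmooth
  simp only [proj, bumpCos_coe]
  fun_prop

lemma isSmooth_bumpSin (i : Fin 2) : IsSmooth fun z => bumpSin (z i) := by
  unfold IsSmooth
  simp only [proj, bumpSin_coe]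
  fun_prop

lemma isSmooth_ker (n : ℕ) : IsSmooth (ker n) := by
  have h : ∀ i, ContDiff ℝ (⊤ : ℕ∞) fun y : Fin 2 → ℝ => bumpCos (proj y i) := isSmooth_bumpCos
  unfold IsSmooth ker
  simp only [Fin.prod_univ_two]
  exact (((h 0).pow _).div_const _).mul (((h 1).pow _).div_const _)

lemma hasDerivAt_bumpCos (z : UnitAddCircle) :
    HasDerivAt (fun s : ℝ => bumpCos (z + s)) (-(Real.pi * bumpSin z)) 0 := by
  induction z using QuotientAddGroup.induction_on with
  | H r =>
    change HasDerivAt (fun s : ℝ => bumpCos ((r + s : ℝ) : UnitAddCircle))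
      (-(Real.pi * bumpSin (r : UnitAddCircle))) 0
    simp only [bumpCos_coe, bumpSin_coe]
    have h1 : HasDerivAt (fun s : ℝ => 2 * Real.pi * (r + s)) (2 * Real.pi) 0 := by
      simpa using ((hasDerivAt_id (0 : ℝ)).const_add r).const_mul (2 * Real.pi)
    have h2 := (h1.cos.const_add 1).div_const 2
    convert! h2 using 1
    simp only [add_zero]; ring

lemma partialDeriv_ker (n : ℕ) (j : Fin 2) (z : Torus) :
    partialDeriv j (ker n) z = dker n j z := by
  have hj : (1 - j) ≠ j := by fin_cases j <;> decide
  have h1 : HasDerivAt (fun s : ℝ => bumpCos ((z + proj (Pi.single j s)) j) ^ (n + 1) *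
      bumpCos ((z + proj (Pi.single j s)) (1 - j)) ^ (n + 1) / bumpMoment (n + 1) ^ 2)
      (dker n j z) 0 := by
    have h2 : ∀ s : ℝ, (z + proj (Pi.single j s)) j = z j + s := by
      intro s; simp [proj]
    have h3 : ∀ s : ℝ, (z + proj (Pi.single j s)) (1 - j) = z (1 - j) := by
      intro s; simp [proj, Pi.single_eq_of_ne hj]
    simp only [h2, h3]
    have h4 := (((hasDerivAt_bumpCos (z j)).pow (n + 1)).mul_const
      (bumpCos (z (1 - j)) ^ (n + 1))).div_const (bumpMoment (n + 1) ^ 2)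
    convert! h4 using 1
    unfold dker
    simp
    ring
  simp only [← ker_eq] at h1
  exact h1.deriv

end

/-- `ρ (x - y)` is a finite sum of products of smooth functions of `x` and of `y`. -/
def IsSeparable (ρ : Torus → ℝ) : Prop :=
  ∃ (N : ℕ) (a b : Fin N → Torus → ℝ), (∀ l, IsSmooth (a l)) ∧ (∀ l, IsSmooth (b l)) ∧
    ∀ x y, ρ (x - y) = ∑ l, a l x * b l y

lemma IsSeparable.of_fintype {κ : Type*} [Fintype κ] {ρ : Torus → ℝ} {a b : κ → Torus → ℝ}
    (ha : ∀ l, IsSmooth (a l)) (hb : ∀ l, IsSmooth (b l))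
    (h : ∀ x y, ρ (x - y) = ∑ l, a l x * b l y) : IsSeparable ρ := by
  let e := Fintype.equivFin κ
  refine ⟨Fintype.card κ, fun l => a (e.symm l), fun l => b (e.symm l), fun l => ha _,
    fun l => hb _, fun x y => ?_⟩
  rw [h]
  exact (Equiv.sum_comp e.symm (fun l => a l x * b l y)).symm

lemma IsSeparable.const (c : ℝ) : IsSeparable fun _ => c :=
  IsSeparable.of_fintype (κ := Unit) (a := fun _ _ => c) (b := fun _ _ => 1)
    (fun _ => isSmooth_const _) (fun _ => isSmooth_const _) (by simp)

lemma IsSeparable.mul {ρ σ : Torus → ℝ} (hρ : IsSeparable ρ) (hσ : IsSeparable σ) :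
    IsSeparable fun z => ρ z * σ z := by
  obtain ⟨N, a, b, ha, hb, h⟩ := hρ
  obtain ⟨N', a', b', ha', hb', h'⟩ := hσ
  refine IsSeparable.of_fintype (κ := Fin N × Fin N') (a := fun l x => a l.1 x * a' l.2 x)
    (b := fun l x => b l.1 x * b' l.2 x) (fun l => (ha _).mul (ha' _))
    (fun l => (hb _).mul (hb' _)) fun x y => ?_
  rw [h, h', Finset.sum_mul_sum, Fintype.sum_prod_type]
  exact Finset.sum_congr rfl fun i _ => Finset.sum_congr rfl fun j _ => by ring

lemma IsSeparable.pow {ρ : Torus → ℝ} (hρ : IsSeparable ρ) (n : ℕ) :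
    IsSeparable fun z => ρ z ^ n := by
  induction n with
  | zero => simpa using IsSeparable.const 1
  | succ n ih => simpa only [pow_succ] using ih.mul hρ

/-- The addition formula `bumpCos_sub` has three terms, one for each index of the sum. -/
lemma isSeparable_bumpCos (i : Fin 2) : IsSeparable fun z => bumpCos (z i) := by
  have hc := isSmooth_bumpCos i
  have hs := isSmooth_bumpSin i
  have hc' : IsSmooth fun z => 2 * bumpCos (z i) + (-1) :=
    ((isSmooth_const 2).mul hc).add (isSmooth_const _)
  refine IsSeparable.of_fintype (κ := Fin 3)
    (a := ![fun _ => 1 / 2, fun z => (1 / 2) * (2 * bumpCos (z i) + (-1)),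
      fun z => (1 / 2) * bumpSin (z i)])
    (b := ![fun _ => 1, fun z => 2 * bumpCos (z i) + (-1), fun z => bumpSin (z i)]) ?_ ?_ ?_
  · intro l
    fin_cases l
    · exact isSmooth_const _
    · exact (isSmooth_const _).mul hc'
    · exact (isSmooth_const _).mul hs
  · intro l
    fin_cases l
    · exact isSmooth_const _
    · exact hc'
    · exact hs
  · intro x y
    rw [Pi.sub_apply, bumpCos_sub]
    simp [Fin.sum_univ_three]
    ring

lemma isSeparable_ker (n : ℕ) : IsSeparable (ker n) := by
  unfold ker
  simp only [Fin.prod_univ_two, div_eq_mul_inv]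
  exact (((isSeparable_bumpCos 0).pow _).mul (.const _)).mul
    (((isSeparable_bumpCos 1).pow _).mul (.const _))

end SoftmaxEuler

namespace SoftmaxEuler

open MeasureTheory

/-! ### Fourier series of functions on the torus -/

noncomputable section

open UnitAddTorus Filter Topology

/-- The Fourier basis is orthonormal for the product of the Haar probability measures; on a circle
of length one this is Lebesgue measure. -/
lemma pi_haarAddCircle_eq_volume :
    (Measure.pi fun _ : Fin 2 => (AddCircle.haarAddCircle : Measure UnitAddCircle)) =
      (volume : Measure Torus) := by
  rw [volume_pi]
  congr 1
  funext i
  rw [AddCircle.volume_eq_smul_haarAddCircle]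
  simp

lemma hasSum_sq_integral_mFourier {f : Torus → ℂ} (hf : MemLp f 2) :
    HasSum (fun k : Fin 2 → ℤ => ‖∫ x, mFourier (-k) x * f x‖ ^ 2) (∫ x, ‖f x‖ ^ 2) := by
  rw [← pi_haarAddCircle_eq_volume] at hf ⊢
  have h := UnitAddTorus.hasSum_sq_mFourierCoeff (hf.toLp f)
  have hc := hf.coeFn_toLp
  convert! h using 1
  · ext k
    unfold mFourierCoeff
    congr 2
    refine integral_congr_ae ?_
    filter_upwards [hc] with x hx
    rw [hx, smul_eq_mul]
  · refine integral_congr_ae ?_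
    filter_upwards [hc] with x hx
    rw [hx]

lemma exists_memLp_integral_mFourier_eq {c : (Fin 2 → ℤ) → ℂ} (hc : Summable fun k => ‖c k‖ ^ 2) :
    ∃ U : Torus → ℂ, MemLp U 2 ∧ ∀ k, ∫ x, mFourier (-k) x * U x = c k := by
  rw [← pi_haarAddCircle_eq_volume]
  let c' : lp (fun _ : Fin 2 → ℤ => ℂ) 2 := ⟨c, memℓp_gen (by simpa using hc)⟩
  refine ⟨_, Lp.memLp ((mFourierBasis (d := Fin 2)).repr.symm c'), fun k => ?_⟩
  have h := mFourierBasis_repr ((mFourierBasis (d := Fin 2)).repr.symm c') k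
  rw [LinearIsometryEquiv.apply_symm_apply] at h
  exact h.symm

/-- The positive and negative parts of `r` are densities of two finite measures with the same
integrals of continuous functions. The measures coincide, hence so do the densities. -/
lemma ae_eq_zero_of_integral_continuous_mul_eq_zero {r : Torus → ℝ} (hr : Integrable r)
    (h : ∀ g : Torus → ℝ, Continuous g → ∫ x, g x * r x = 0) : r =ᵐ[volume] 0 := by
  have hp : AEMeasurable (fun x => ENNReal.ofReal (r x)) := hr.aemeasurable.ennreal_ofReal
  have hn : AEMeasurable (fun x => ENNReal.ofReal ((-r) x)) := hr.neg.aemeasurable.ennreal_ofReal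
  have := isFiniteMeasure_withDensity_ofReal hr.2
  have := isFiniteMeasure_withDensity_ofReal hr.neg.2
  have key : (volume : Measure Torus).withDensity (fun x => ENNReal.ofReal (r x)) =
      (volume : Measure Torus).withDensity (fun x => ENNReal.ofReal ((-r) x)) := by
    refine ext_of_forall_integral_eq_of_IsFiniteMeasure fun g => ?_
    rw [integral_withDensity_eq_integral_toReal_smul₀ hp (by simp),
      integral_withDensity_eq_integral_toReal_smul₀ hn (by simp), ← sub_eq_zero, ← integral_sub]
    · rw [← h g g.continuous]
      refine integral_congr_ae (ae_of_all _ fun x => ?_)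
      simp only [smul_eq_mul, ENNReal.toReal_ofReal', Pi.neg_apply]
      rcases le_total (r x) 0 with h1 | h1
      · rw [max_eq_right h1, max_eq_left (by linarith)]; ring
      · rw [max_eq_left h1, max_eq_right (by linarith)]; ring
    · simp only [ENNReal.toReal_ofReal', smul_eq_mul]
      exact (hr.pos_part).mul_bdd (c := ‖g‖) g.continuous.aestronglyMeasurable
        (ae_of_all _ fun x => g.norm_coe_le_norm x)
    · simp only [ENNReal.toReal_ofReal', smul_eq_mul]
      exact (hr.neg.pos_part).mul_bdd (c := ‖g‖) g.continuous.aestronglyMeasurable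
        (ae_of_all _ fun x => g.norm_coe_le_norm x)
  rw [withDensity_eq_iff_of_sigmaFinite hp hn] at key
  filter_upwards [key] with x hx
  have h1 := congrArg ENNReal.toReal hx
  simp only [ENNReal.toReal_ofReal', Pi.neg_apply] at h1
  rcases le_total (r x) 0 with h2 | h2
  · rw [max_eq_right h2, max_eq_left (by linarith)] at h1
    simp; linarith
  · rw [max_eq_left h2, max_eq_right (by linarith)] at h1
    simpa using h1

/-- The functional `g ↦ ∫ g h` is continuous for the uniform norm and vanishes on the characters,
whose span is dense. -/
lemma integral_continuous_mul_eq_zero {h : Torus → ℂ} (hh : Integrable h)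
    (h0 : ∀ k : Fin 2 → ℤ, ∫ x, mFourier k x * h x = 0) (g : C(Torus, ℂ)) :
    ∫ x, g x * h x = 0 := by
  have hi : ∀ g : C(Torus, ℂ), Integrable fun x => g x * h x := fun g =>
    hh.bdd_mul (c := ‖g‖) g.continuous.aestronglyMeasurable
      (ae_of_all _ fun x => g.norm_coe_le_norm x)
  let L : C(Torus, ℂ) →ₗ[ℂ] ℂ :=
    { toFun := fun g => ∫ x, g x * h x
      map_add' := fun f g => by
        simp only [ContinuousMap.add_apply, add_mul]
        exact integral_add (hi f) (hi g)
      map_smul' := fun c g => by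
        simp only [ContinuousMap.smul_apply, smul_eq_mul, mul_assoc, RingHom.id_apply]
        exact integral_const_mul _ _ }
  let L' : C(Torus, ℂ) →L[ℂ] ℂ := L.mkContinuous (∫ x, ‖h x‖) fun g => by
    change ‖∫ x, g x * h x‖ ≤ _
    rw [mul_comm, ← integral_const_mul]
    refine norm_integral_le_of_norm_le (hh.norm.const_mul _) (ae_of_all _ fun x => ?_)
    rw [norm_mul]
    exact mul_le_mul_of_nonneg_right (g.norm_coe_le_norm x) (norm_nonneg _)
  have hL : L' = 0 := by
    refine ContinuousLinearMap.ext_on (s := Set.range (mFourier (d := Fin 2))) ?_ ?_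
    · rw [Submodule.dense_iff_topologicalClosure_eq_top]
      exact span_mFourier_closure_eq_top
    · rintro _ ⟨k, rfl⟩
      exact h0 k
  exact congrArg (fun T : C(Torus, ℂ) →L[ℂ] ℂ => T g) hL

lemma ae_eq_zero_of_integral_mFourier_eq_zero {h : Torus → ℂ} (hh : Integrable h)
    (h0 : ∀ k : Fin 2 → ℤ, ∫ x, mFourier k x * h x = 0) : h =ᵐ[volume] 0 := by
  have key : ∀ g : Torus → ℝ, Continuous g → ∫ x, (g x : ℂ) * h x = 0 := fun g hg =>
    integral_continuous_mul_eq_zero hh h0 ⟨fun x => (g x : ℂ), by fun_prop⟩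
  have hi : ∀ g : Torus → ℝ, Continuous g → Integrable fun x => (g x : ℂ) * h x := by
    intro g hg
    obtain ⟨C, hC⟩ := isCompact_univ.exists_bound_of_continuousOn hg.continuousOn
    refine hh.bdd_mul (c := C) (by fun_prop) (ae_of_all _ fun x => ?_)
    simpa using hC x trivial
  have h1 : (fun x => (h x).re) =ᵐ[volume] 0 := by
    refine ae_eq_zero_of_integral_continuous_mul_eq_zero hh.re fun g hg => ?_
    have := congrArg Complex.re (key g hg)
    rw [← RCLike.re_eq_complex_re, ← integral_re (hi g hg)] at this
    simpa using this
  have h2 : (fun x => (h x).im) =ᵐ[volume] 0 := by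
    refine ae_eq_zero_of_integral_continuous_mul_eq_zero hh.im fun g hg => ?_
    have := congrArg Complex.im (key g hg)
    rw [← RCLike.im_eq_complex_im, ← integral_im (hi g hg)] at this
    simpa using this
  filter_upwards [h1, h2] with x hx1 hx2
  exact Complex.ext hx1 hx2

/-- The Fourier coefficients of a real function on the torus. -/
def coef (f : Torus → ℝ) (k : Fin 2 → ℤ) : ℂ := ∫ x, mFourier (-k) x * f x

lemma hasSum_sq_coef {f : Torus → ℝ} (hf : MemLp f 2) :
    HasSum (fun k => ‖coef f k‖ ^ 2) (∫ x, f x ^ 2) := by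
  simpa [coef] using hasSum_sq_integral_mFourier hf.ofReal

/-- Riesz–Fischer produces an `L²` function with the same coefficients, and coefficients determine
an integrable function. This lifts the velocity from `L¹`, which is all that the weak formulation
gives, to `L²`. -/
lemma memLp_two_of_summable_sq_coef {f : Torus → ℝ} (hf : Integrable f)
    (h : Summable fun k => ‖coef f k‖ ^ 2) : MemLp f 2 := by
  obtain ⟨U, hU, hUc⟩ := exists_memLp_integral_mFourier_eq h
  have hUi : Integrable U := hU.integrable (by simp)
  have hfi : Integrable fun x => (f x : ℂ) := hf.ofReal
  have hb : ∀ {g : Torus → ℂ}, Integrable g → ∀ k : Fin 2 → ℤ,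
      Integrable fun x => mFourier k x * g x := fun {g} hg k =>
    hg.bdd_mul (c := ‖mFourier k‖) (mFourier k).continuous.aestronglyMeasurable
      (ae_of_all _ fun x => (mFourier k).norm_coe_le_norm x)
  have h1 : (fun x => (f x : ℂ) - U x) =ᵐ[volume] 0 := by
    refine ae_eq_zero_of_integral_mFourier_eq_zero (hfi.sub hUi) fun k => ?_
    simp only [mul_sub]
    rw [integral_sub (hb hfi k) (hb hUi k), sub_eq_zero]
    have := hUc (-k)
    rw [coef, neg_neg] at this
    exact this.symm
  have h2 : f =ᵐ[volume] fun x => (U x).re := by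
    filter_upwards [h1] with x hx
    have := congrArg Complex.re hx
    simp at this
    linarith
  exact (memLp_congr_ae h2).2 hU.re

/-- The squared `L²` modulus of continuity. -/
def modulus (f : Torus → ℝ) (z : Torus) : ℝ := ∫ x, (f (x - z) - f x) ^ 2

/-! ### Moduli of continuity via Parseval -/

lemma mFourier_apply_add (k : Fin 2 → ℤ) (x z : Torus) :
    mFourier k (x + z) = mFourier k x * mFourier k z := by
  simp only [mFourier, ContinuousMap.coe_mk, Pi.add_apply, ← Finset.prod_mul_distrib]
  refine Finset.prod_congr rfl fun i _ => ?_
  simp [fourier_apply, smul_add, AddCircle.toCircle_add]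

lemma coef_comp_sub (f : Torus → ℝ) (k : Fin 2 → ℤ) (z : Torus) :
    coef (fun x => f (x - z)) k = mFourier (-k) z * coef f k := by
  have := integral_add_right_eq_self (μ := volume)
    (fun x : Torus => mFourier (-k) x * (f (x - z) : ℂ)) z
  rw [coef, ← this, coef, ← integral_const_mul]
  simp only [add_sub_cancel_right, mFourier_apply_add]
  refine integral_congr_ae (ae_of_all _ fun x => ?_)
  ring

lemma memLp_comp_sub {f : Torus → ℝ} {p : ENNReal} (hf : MemLp f p) (z : Torus) :
    MemLp (fun x => f (x - z)) p :=
  hf.comp_measurePreserving (measurePreserving_sub_right volume z)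

/-- Translation multiplies each coefficient by a character, so this is Parseval for the difference
of `f` and its translate. -/
lemma hasSum_modulus {f : Torus → ℝ} (hf : MemLp f 2) (z : Torus) :
    HasSum (fun k => ‖mFourier (-k) z - 1‖ ^ 2 * ‖coef f k‖ ^ 2) (modulus f z) := by
  have h := hasSum_sq_coef ((memLp_comp_sub hf z).sub hf)
  convert! h using 1
  ext k
  rw [← mul_pow, ← norm_mul, sub_mul, one_mul, ← coef_comp_sub]
  congr 2
  have hb : ∀ {g : Torus → ℝ}, MemLp g 2 →
      Integrable fun x => mFourier (-k) x * (g x : ℂ) := fun {g} hg =>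
    ((hg.integrable (by simp)).ofReal (𝕜 := ℂ)).bdd_mul (c := ‖mFourier (-k)‖)
      (mFourier (-k)).continuous.aestronglyMeasurable
      (ae_of_all _ fun x => (mFourier (-k)).norm_coe_le_norm x)
  unfold coef
  rw [← integral_sub (hb (memLp_comp_sub hf z)) (hb hf)]
  refine integral_congr_ae (ae_of_all _ fun x => ?_)
  simp [mul_sub]

/-- Telescoping `wⁿ - 1` for `|w| = 1`; negative frequencies follow by conjugation. -/
lemma norm_fourier_sub_one_le (n : ℤ) (z : UnitAddCircle) :
    ‖(fourier n z : ℂ) - 1‖ ≤ |(n : ℝ)| * ‖(fourier 1 z : ℂ) - 1‖ := by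
  have hnat : ∀ m : ℕ, ‖(fourier (m : ℤ) z : ℂ) - 1‖ ≤ m * ‖(fourier 1 z : ℂ) - 1‖ := by
    intro m
    induction m with
    | zero => simp
    | succ m ih =>
      have h1 : (fourier ((m + 1 : ℕ) : ℤ) z : ℂ) - 1 =
          (fourier (m : ℤ) z) * ((fourier 1 z : ℂ) - 1) + ((fourier (m : ℤ) z : ℂ) - 1) := by
        push_cast
        rw [fourier_add]; ring
      rw [h1]
      refine (norm_add_le _ _).trans ?_
      have h2 : ‖(fourier (m : ℤ) z : ℂ)‖ = 1 := Circle.norm_coe _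
      rw [norm_mul, h2]
      push_cast
      linarith
  obtain ⟨m, rfl | rfl⟩ := n.eq_nat_or_neg
  · simpa using hnat m
  · have h1 : (fourier (-(m : ℤ)) z : ℂ) - 1 =
        (starRingEnd ℂ) ((fourier (m : ℤ) z : ℂ) - 1) := by
      rw [fourier_neg]; simp
    rw [h1, Complex.norm_conj]
    simpa using hnat m

/-- The square of the Euclidean norm of a frequency. -/
def freqSq (k : Fin 2 → ℤ) : ℝ := ∑ i, (k i : ℝ) ^ 2

lemma norm_mFourier_sub_one_sq_le (k : Fin 2 → ℤ) (z : Torus) :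
    ‖mFourier (-k) z - 1‖ ^ 2 ≤ 2 * freqSq k * wgt z := by
  have h1 : mFourier (-k) z - 1 = (fourier (-k 0) (z 0) : ℂ) * ((fourier (-k 1) (z 1) : ℂ) - 1) +
      ((fourier (-k 0) (z 0) : ℂ) - 1) := by
    simp only [mFourier, ContinuousMap.coe_mk, Fin.prod_univ_two, Pi.neg_apply]
    ring
  have h2 : ‖(fourier (-k 0) (z 0) : ℂ)‖ = 1 := Circle.norm_coe _
  have h3 := norm_fourier_sub_one_le (-k 0) (z 0)
  have h4 := norm_fourier_sub_one_le (-k 1) (z 1)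
  have h5 : ‖mFourier (-k) z - 1‖ ≤ |((-k 1 : ℤ) : ℝ)| * ‖(fourier 1 (z 1) : ℂ) - 1‖ +
      |((-k 0 : ℤ) : ℝ)| * ‖(fourier 1 (z 0) : ℂ) - 1‖ := by
    rw [h1]
    refine (norm_add_le _ _).trans ?_
    rw [norm_mul, h2]
    linarith
  push_cast at h5
  rw [abs_neg, abs_neg] at h5
  have h6 := norm_fourier_one_sub_one_sq (z 0)
  have h7 := norm_fourier_one_sub_one_sq (z 1)
  have h8 : freqSq k = |(k 0 : ℝ)| ^ 2 + |(k 1 : ℝ)| ^ 2 := by simp [freqSq, sq_abs]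
  have h9 : wgt z = ‖(fourier 1 (z 0) : ℂ) - 1‖ ^ 2 + ‖(fourier 1 (z 1) : ℂ) - 1‖ ^ 2 := by
    rw [h6, h7, wgt, Fin.sum_univ_two]
  rw [h8, h9]
  generalize |(k 0 : ℝ)| = a at *
  generalize |(k 1 : ℝ)| = b at *
  generalize ‖(fourier 1 (z 0) : ℂ) - 1‖ = s at *
  generalize ‖(fourier 1 (z 1) : ℂ) - 1‖ = t at *
  calc ‖mFourier (-k) z - 1‖ ^ 2 ≤ (b * t + a * s) ^ 2 := by gcongr
    _ ≤ _ := by nlinarith [sq_nonneg (b * t - a * s), sq_nonneg (a * t), sq_nonneg (b * s)]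

lemma norm_mFourier_sub_one_sq_le_four (k : Fin 2 → ℤ) (z : Torus) :
    ‖mFourier (-k) z - 1‖ ^ 2 ≤ 4 := by
  have h : ‖mFourier (-k) z‖ ≤ 1 := by
    simpa [mFourier_norm] using (mFourier (-k)).norm_coe_le_norm z
  have h2 : ‖mFourier (-k) z - 1‖ ≤ 2 := by
    refine (norm_sub_le _ _).trans ?_
    rw [norm_one]; linarith
  nlinarith [norm_nonneg (mFourier (-k) z - 1)]

/-- Quantitative continuity of translations in `L²`: finitely many frequencies contribute a multiple
of `wgt`, and the tail is small uniformly in `z`. -/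
lemma exists_modulus_le {f : Torus → ℝ} (hf : MemLp f 2) {ε : ℝ} (hε : 0 < ε) :
    ∃ C : ℝ, 0 ≤ C ∧ ∀ z, modulus f z ≤ ε + C * wgt z := by
  classical
  have hs := hasSum_sq_coef hf
  -- The tail beyond `S` has mass below `ε / 4`, because the multiplier there is at most `4`.
  obtain ⟨S, hS⟩ := (hs.eventually (lt_mem_nhds (sub_lt_self (∫ x, f x ^ 2)
    (show 0 < ε / 4 by positivity)))).exists
  have hnn : ∀ k, 0 ≤ 2 * freqSq k * ‖coef f k‖ ^ 2 := fun k => by unfold freqSq; positivity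
  refine ⟨∑ k ∈ S, 2 * freqSq k * ‖coef f k‖ ^ 2, Finset.sum_nonneg fun k _ => hnn k, fun z => ?_⟩
  have h1 : HasSum (fun k => if k ∈ S then 2 * freqSq k * ‖coef f k‖ ^ 2 * wgt z else 0)
      (∑ k ∈ S, 2 * freqSq k * ‖coef f k‖ ^ 2 * wgt z) := by
    have := hasSum_sum_of_ne_finset_zero (s := S) (L := SummationFilter.unconditional _)
      (f := fun k => if k ∈ S then 2 * freqSq k * ‖coef f k‖ ^ 2 * wgt z else 0)
      (fun k hk => if_neg hk)
    rwa [Finset.sum_congr rfl fun k hk => if_pos hk] at this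
  have h2 : HasSum (fun k => if k ∈ S then ‖coef f k‖ ^ 2 else 0) (∑ k ∈ S, ‖coef f k‖ ^ 2) := by
    have := hasSum_sum_of_ne_finset_zero (s := S) (L := SummationFilter.unconditional _)
      (f := fun k => if k ∈ S then ‖coef f k‖ ^ 2 else 0)
      (fun k hk => if_neg hk)
    rwa [Finset.sum_congr rfl fun k hk => if_pos hk] at this
  have h3 := h1.add ((hs.sub h2).mul_left 4)
  have h4 := hasSum_le (fun k => ?_) (hasSum_modulus hf z) h3
  · rw [← Finset.sum_mul] at h4
    linarith
  · by_cases hk : k ∈ S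
    · simp only [hk, if_true, sub_self, mul_zero, add_zero]
      have := mul_le_mul_of_nonneg_right (norm_mFourier_sub_one_sq_le k z)
        (sq_nonneg ‖coef f k‖)
      linarith
    · simp only [hk, if_false, sub_zero, zero_add]
      exact mul_le_mul_of_nonneg_right (norm_mFourier_sub_one_sq_le_four k z) (sq_nonneg _)

lemma modulus_le_of_coef {f g : Torus → ℝ} (hf : MemLp f 2) (hg : MemLp g 2)
    (h : ∀ k, freqSq k * ‖coef f k‖ ^ 2 ≤ ‖coef g k‖ ^ 2) (z : Torus) :
    modulus f z ≤ 2 * wgt z * ∫ x, g x ^ 2 := by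
  refine hasSum_le (fun k => ?_) (hasSum_modulus hf z) ((hasSum_sq_coef hg).mul_left (2 * wgt z))
  have h1 := mul_le_mul_of_nonneg_right (norm_mFourier_sub_one_sq_le k z) (sq_nonneg ‖coef f k‖)
  have h2 := mul_le_mul_of_nonneg_left (h k) (wgt_nonneg z)
  linarith

end

end SoftmaxEuler

namespace SoftmaxEuler

open MeasureTheory

/-! ### Regularity of the velocity field -/

noncomputable section

open UnitAddTorus Filter Topology

/-- The real part of `mFourier k`. -/
def cosMode (k : Fin 2 → ℤ) (x : Torus) : ℝ := (mFourier k x).re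

/-- The imaginary part of `mFourier k`. -/
def sinMode (k : Fin 2 → ℤ) (x : Torus) : ℝ := (mFourier k x).im

lemma mFourier_proj (k : Fin 2 → ℤ) (y : Fin 2 → ℝ) :
    mFourier k (proj y) = Complex.exp ((∑ i, 2 * Real.pi * k i * y i : ℝ) * Complex.I) := by
  simp only [mFourier, ContinuousMap.coe_mk, proj, fourier_coe_apply, Fin.prod_univ_two,
    Fin.sum_univ_two]
  rw [← Complex.exp_add]
  congr 1; push_cast; ring

lemma cosMode_proj (k : Fin 2 → ℤ) (y : Fin 2 → ℝ) :
    cosMode k (proj y) = Real.cos (∑ i, 2 * Real.pi * k i * y i) := by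
  rw [cosMode, mFourier_proj, Complex.exp_ofReal_mul_I_re]

lemma sinMode_proj (k : Fin 2 → ℤ) (y : Fin 2 → ℝ) :
    sinMode k (proj y) = Real.sin (∑ i, 2 * Real.pi * k i * y i) := by
  rw [sinMode, mFourier_proj, Complex.exp_ofReal_mul_I_im]

lemma isSmooth_cosMode (k : Fin 2 → ℤ) : IsSmooth (cosMode k) := by
  unfold IsSmooth
  simp only [cosMode_proj]
  fun_prop

lemma isSmooth_sinMode (k : Fin 2 → ℤ) : IsSmooth (sinMode k) := by
  unfold IsSmooth
  simp only [sinMode_proj]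
  fun_prop

lemma hasDerivAt_phase (k : Fin 2 → ℤ) (i : Fin 2) (y : Fin 2 → ℝ) :
    HasDerivAt (fun s : ℝ => ∑ j, 2 * Real.pi * k j * (y + (Pi.single i s : Fin 2 → ℝ)) j)
      (2 * Real.pi * k i) 0 := by
  have h : ∀ s : ℝ, ∑ j, 2 * Real.pi * k j * (y + (Pi.single i s : Fin 2 → ℝ)) j =
      ∑ j, 2 * Real.pi * k j * y j + 2 * Real.pi * k i * s := by
    intro s
    simp only [Pi.add_apply, mul_add, Finset.sum_add_distrib]
    congr 1
    rw [Finset.sum_eq_single i (fun j _ hj => by rw [Pi.single_eq_of_ne hj, mul_zero]) (by simp),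
      Pi.single_eq_same]
  simp only [h]
  simpa using ((hasDerivAt_id (0 : ℝ)).const_mul (2 * Real.pi * k i)).const_add
    (∑ j, 2 * Real.pi * k j * y j)

lemma partialDeriv_cosMode (k : Fin 2 → ℤ) (i : Fin 2) (x : Torus) :
    partialDeriv i (cosMode k) x = -(2 * Real.pi * k i) * sinMode k x := by
  obtain ⟨y, rfl⟩ := proj_surjective x
  unfold partialDeriv
  simp only [← proj_add, cosMode_proj, sinMode_proj]
  rw [(hasDerivAt_phase k i y).cos.deriv]
  simp only [Pi.single_zero, add_zero]
  ring

lemma partialDeriv_sinMode (k : Fin 2 → ℤ) (i : Fin 2) (x : Torus) :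
    partialDeriv i (sinMode k) x = 2 * Real.pi * k i * cosMode k x := by
  obtain ⟨y, rfl⟩ := proj_surjective x
  unfold partialDeriv
  simp only [← proj_add, cosMode_proj, sinMode_proj]
  rw [(hasDerivAt_phase k i y).sin.deriv]
  simp only [Pi.single_zero, add_zero]
  ring

lemma IsSmooth.partialDeriv_const_mul {η : Torus → ℝ} (h : IsSmooth η) (c : ℝ) (i : Fin 2)
    (x : Torus) : SoftmaxEuler.partialDeriv i (fun x => c * η x) x =
      c * SoftmaxEuler.partialDeriv i η x :=
  ((h.hasDerivAt i x).const_mul c).deriv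

lemma laplacian_cosMode (k : Fin 2 → ℤ) (x : Torus) :
    laplacian (cosMode k) x = -(4 * Real.pi ^ 2 * freqSq k) * cosMode k x := by
  unfold laplacian
  have h : ∀ i, partialDeriv i (cosMode k) = fun x => -(2 * Real.pi * k i) * sinMode k x :=
    fun i => funext (partialDeriv_cosMode k i)
  simp only [h, (isSmooth_sinMode k).partialDeriv_const_mul, partialDeriv_sinMode, freqSq,
    Fin.sum_univ_two]
  ring

lemma laplacian_sinMode (k : Fin 2 → ℤ) (x : Torus) :
    laplacian (sinMode k) x = -(4 * Real.pi ^ 2 * freqSq k) * sinMode k x := by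
  unfold laplacian
  have h : ∀ i, partialDeriv i (sinMode k) = fun x => 2 * Real.pi * k i * cosMode k x :=
    fun i => funext (partialDeriv_sinMode k i)
  simp only [h, (isSmooth_cosMode k).partialDeriv_const_mul, partialDeriv_cosMode, freqSq,
    Fin.sum_univ_two]
  ring

lemma _root_.MeasureTheory.Integrable.mul_continuous {f g : Torus → ℝ} (hf : Integrable f)
    (hg : Continuous g) : Integrable fun x => f x * g x := by
  obtain ⟨C, hC⟩ := isCompact_univ.exists_bound_of_continuousOn hg.continuousOn
  exact hf.mul_bdd (c := C) hg.aestronglyMeasurable (ae_of_all _ fun x => hC x trivial)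

/-- The weak formulations have real test functions, so a complex coefficient is read off from a
cosine and a sine test. -/
lemma coef_eq {f : Torus → ℝ} (hf : Integrable f) (k : Fin 2 → ℤ) :
    coef f k = (∫ x, f x * cosMode k x : ℝ) - (∫ x, f x * sinMode k x : ℝ) * Complex.I := by
  rw [← integral_complex_ofReal, ← integral_complex_ofReal, ← integral_mul_const, coef,
    ← integral_sub]
  · refine integral_congr_ae (ae_of_all _ fun x => ?_)
    simp only
    rw [mFourier_neg]
    apply Complex.ext <;> simp [cosMode, sinMode, mul_comm]
  · exact (hf.mul_continuous (isSmooth_cosMode k).continuous).ofReal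
  · exact (hf.mul_continuous (isSmooth_sinMode k).continuous).ofReal.mul_const _

lemma coef_of_hasWeakPartial {i : Fin 2} {f g : Torus → ℝ} (h : HasWeakPartial i f g)
    (k : Fin 2 → ℤ) : coef g k = (2 * Real.pi * k i : ℝ) * Complex.I * coef f k := by
  obtain ⟨hf, hg, h⟩ := h
  rw [coef_eq hf, coef_eq hg, h _ (isSmooth_cosMode k), h _ (isSmooth_sinMode k)]
  simp only [partialDeriv_cosMode, partialDeriv_sinMode]
  have h1 : ∫ x, f x * (-(2 * Real.pi * k i) * sinMode k x) =
      -(2 * Real.pi * k i) * ∫ x, f x * sinMode k x := by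
    rw [← integral_const_mul]; congr 1; ext x; ring
  have h2 : ∫ x, f x * (2 * Real.pi * k i * cosMode k x) =
      2 * Real.pi * k i * ∫ x, f x * cosMode k x := by
    rw [← integral_const_mul]; congr 1; ext x; ring
  rw [h1, h2]
  apply Complex.ext <;> simp

lemma coef_of_laplacian {ψ w : Torus → ℝ} (hψ : Integrable ψ) (hw : Integrable w)
    (h : ∀ η : Torus → ℝ, IsSmooth η → ∫ x, ψ x * (-laplacian η x) = ∫ x, w x * η x)
    (k : Fin 2 → ℤ) : coef w k = (4 * Real.pi ^ 2 * freqSq k : ℝ) * coef ψ k := by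
  rw [coef_eq hψ, coef_eq hw, ← h _ (isSmooth_cosMode k), ← h _ (isSmooth_sinMode k)]
  simp only [laplacian_cosMode, laplacian_sinMode]
  have h1 : ∀ η : Torus → ℝ, ∫ x, ψ x * (-(-(4 * Real.pi ^ 2 * freqSq k) * η x)) =
      (4 * Real.pi ^ 2 * freqSq k) * ∫ x, ψ x * η x := by
    intro η
    rw [← integral_const_mul]; congr 1; ext x; ring
  rw [h1, h1]
  push_cast
  ring

/-- The velocity field `v` is square integrable, weakly divergence free, and
has one derivative in `L²`, with norm controlled by `M`. -/
structure IsSobolevField (M : ℝ) (v : Torus → Fin 2 → ℝ) : Prop where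
  memLp : ∀ j, MemLp (fun x => v x j) 2
  modulus_le : ∀ j z, modulus (fun x => v x j) z ≤ M * wgt z
  integral_sq_le : ∀ j, ∫ x, v x j ^ 2 ≤ M
  div_free : ∀ η : Torus → ℝ, IsSmooth η → ∫ x, ∑ j, v x j * partialDeriv j η x = 0

lemma freqSq_one_le {k : Fin 2 → ℤ} (h : freqSq k ≠ 0) : 1 ≤ freqSq k := by
  have h1 : freqSq k = ((∑ i, k i ^ 2 : ℤ) : ℝ) := by simp [freqSq]
  rw [h1] at h ⊢
  have h2 : 0 ≤ ∑ i, k i ^ 2 := Finset.sum_nonneg fun i _ => sq_nonneg _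
  have h3 : (∑ i, k i ^ 2 : ℤ) ≠ 0 := by exact_mod_cast h
  exact_mod_cast (by omega : 1 ≤ ∑ i, k i ^ 2)

lemma freq_sq_le_freqSq (k : Fin 2 → ℤ) (i : Fin 2) : (k i : ℝ) ^ 2 ≤ freqSq k :=
  Finset.single_le_sum (f := fun i => (k i : ℝ) ^ 2) (fun _ _ => sq_nonneg _) (Finset.mem_univ i)

/-- With `v̂` equal to `2πi k^⊥ ψ̂` and `ŵ` to `4π² |k|² ψ̂` at frequency `k`, one has `|k| |v̂| ≤
|ŵ|`. The mean-free vorticity is bounded by `2 * M`; with the factor `2` of `modulus_le_of_coef`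
this gives `8 * M ^ 2`. -/
lemma IsVelocityOf.isSobolevField {w : Torus → ℝ} {v : Torus → Fin 2 → ℝ} (h : IsVelocityOf w v)
    {M : ℝ} (hw : AEStronglyMeasurable w) (hM : ∀ᵐ x, |w x| ≤ M) :
    IsSobolevField (8 * M ^ 2) v := by
  obtain ⟨ψ, h0, h1, h2⟩ := h
  set w' : Torus → ℝ := fun x => w x - ⨍ z, w z with hw'
  have hwi : Integrable w := Integrable.of_bound hw M hM
  have hav : |⨍ z, w z| ≤ M := by
    rw [average_eq_integral]
    have := norm_integral_le_of_norm_le_const (μ := (volume : Measure Torus)) (f := w) hM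
    simpa using this
  have hM' : ∀ᵐ x, ‖w' x‖ ≤ 2 * M := by
    filter_upwards [hM] with x hx
    exact (norm_sub_le _ _).trans (by simp only [Real.norm_eq_abs]; linarith)
  have hwm' : AEStronglyMeasurable w' := hw.sub aestronglyMeasurable_const
  have hw2 : MemLp w' 2 := MemLp.of_bound hwm' _ hM'
  have hwsq : ∫ x, w' x ^ 2 ≤ 4 * M ^ 2 := by
    have := integral_mono_ae (hw2.integrable_sq) (integrable_const (4 * M ^ 2)) (by
      filter_upwards [hM'] with x hx
      rw [← sq_abs]
      calc |w' x| ^ 2 ≤ (2 * M) ^ 2 := by gcongr; exact hx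
        _ = 4 * M ^ 2 := by ring)
    simpa using this
  have hvi : ∀ j, Integrable fun x => v x j := by
    intro j
    fin_cases j
    · exact h0.2.1
    · simpa using h1.2.1.neg
  have hcw := coef_of_laplacian h0.1 (hw2.integrable (by simp)) h2
  have hcoef : ∀ j k, ‖coef (fun x => v x j) k‖ ^ 2 =
      (2 * Real.pi * k (1 - j)) ^ 2 * ‖coef ψ k‖ ^ 2 := by
    intro j k
    fin_cases j
    · have := coef_of_hasWeakPartial h0 k
      simp only [Fin.zero_eta, sub_zero]
      rw [this, norm_mul, norm_mul, Complex.norm_I, mul_one, mul_pow, Complex.norm_real,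
        Real.norm_eq_abs, sq_abs]
    · have := coef_of_hasWeakPartial h1 k
      have hneg : coef (fun x => -v x 1) k = -coef (fun x => v x 1) k := by
        simp [coef, integral_neg]
      simp only [Fin.mk_one, sub_self]
      rw [← norm_neg, ← hneg, this, norm_mul, norm_mul, Complex.norm_I, mul_one, mul_pow,
        Complex.norm_real, Real.norm_eq_abs, sq_abs]
  have hfs : ∀ k, 0 ≤ freqSq k := fun k => Finset.sum_nonneg fun i _ => sq_nonneg _
  have key : ∀ j k, freqSq k * ‖coef (fun x => v x j) k‖ ^ 2 ≤ ‖coef w' k‖ ^ 2 := by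
    intro j k
    rw [hcoef, hcw, norm_mul, Complex.norm_real, Real.norm_eq_abs,
      mul_pow |4 * Real.pi ^ 2 * freqSq k|, sq_abs]
    have hk := freq_sq_le_freqSq k (1 - j)
    have hpi : 1 ≤ 4 * Real.pi ^ 2 := by nlinarith [Real.pi_gt_three]
    calc freqSq k * ((2 * Real.pi * k (1 - j)) ^ 2 * ‖coef ψ k‖ ^ 2)
        = (1 * (4 * Real.pi ^ 2)) * ((k (1 - j) : ℝ) ^ 2 * freqSq k) * ‖coef ψ k‖ ^ 2 := by ring
      _ ≤ ((4 * Real.pi ^ 2) * (4 * Real.pi ^ 2)) * (freqSq k * freqSq k) * ‖coef ψ k‖ ^ 2 := by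
          have := hfs k
          gcongr
      _ = (4 * Real.pi ^ 2 * freqSq k) ^ 2 * ‖coef ψ k‖ ^ 2 := by ring
  -- Nonzero frequencies have `freqSq k ≥ 1`, and at frequency zero the velocity vanishes because it
  -- is a gradient rotated.
  have key2 : ∀ j k, ‖coef (fun x => v x j) k‖ ^ 2 ≤ ‖coef w' k‖ ^ 2 := by
    intro j k
    by_cases hk : freqSq k = 0
    · have h3 := freq_sq_le_freqSq k (1 - j)
      have h4 : (k (1 - j) : ℝ) = 0 := by
        rw [hk] at h3
        exact pow_eq_zero_iff (two_ne_zero) |>.1 (le_antisymm h3 (sq_nonneg _))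
      rw [hcoef, h4]
      simp
    · refine le_trans ?_ (key j k)
      exact le_mul_of_one_le_left (sq_nonneg _) (freqSq_one_le hk)
  have hv2 : ∀ j, MemLp (fun x => v x j) 2 := fun j =>
    memLp_two_of_summable_sq_coef (hvi j)
      (Summable.of_nonneg_of_le (fun k => sq_nonneg _) (key2 j) (hasSum_sq_coef hw2).summable)
  refine ⟨hv2, fun j z => ?_, fun j => ?_, fun η hη => ?_⟩
  · refine (modulus_le_of_coef (hv2 j) hw2 (key j) z).trans ?_
    have := mul_le_mul_of_nonneg_left hwsq (wgt_nonneg z)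
    linarith
  · have := hasSum_le (key2 j) (hasSum_sq_coef (hv2 j)) (hasSum_sq_coef hw2)
    nlinarith [sq_nonneg M]
  -- Moving both derivatives onto the test function leaves `ψ` against two mixed second derivatives,
  -- which cancel.
  · simp only [Fin.sum_univ_two]
    rw [integral_add ((hvi 0).mul_continuous (hη.partialDeriv 0).continuous)
      ((hvi 1).mul_continuous (hη.partialDeriv 1).continuous), h0.2.2 _ (hη.partialDeriv 0)]
    have h3 := h1.2.2 _ (hη.partialDeriv 1)
    simp only [neg_mul, integral_neg, neg_inj] at h3
    rw [h3]
    simp only [hη.partialDeriv_comm 0 1]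
    ring

end

end SoftmaxEuler

namespace SoftmaxEuler

open MeasureTheory

/-! ### Mollification and the commutator estimate -/

noncomputable section

open Filter Topology

/-- The mollification of `f`. -/
def mollify (n : ℕ) (f : Torus → ℝ) (x : Torus) : ℝ := ∫ y, f y * ker n (x - y)

/-- The mollification of `-div (f v)`. -/
def flux (n : ℕ) (v : Torus → Fin 2 → ℝ) (f : Torus → ℝ) (x : Torus) : ℝ :=
  ∫ y, f y * ∑ j, v y j * partialDeriv j (fun y => ker n (x - y)) y

lemma partialDeriv_ker_comp_sub (n : ℕ) (j : Fin 2) (x y : Torus) :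
    partialDeriv j (fun y => ker n (x - y)) y = -dker n j (x - y) := by
  rw [(isSmooth_ker n).partialDeriv_comp_sub_left, partialDeriv_ker]

lemma exists_ker_sub_eq (n : ℕ) : ∃ (N : ℕ) (a b : Fin N → Torus → ℝ), (∀ l, IsSmooth (a l)) ∧
    (∀ l, IsSmooth (b l)) ∧ (∀ x y, ker n (x - y) = ∑ l, a l x * b l y) ∧
    (∀ j x y, dker n j (x - y) = ∑ l, partialDeriv j (a l) x * b l y) ∧
    ∀ j x y, partialDeriv j (fun y => ker n (x - y)) y =
      ∑ l, a l x * partialDeriv j (b l) y := by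
  obtain ⟨N, a, b, ha, hb, h⟩ := isSeparable_ker n
  refine ⟨N, a, b, ha, hb, h, fun j x y => ?_, fun j x y => ?_⟩
  · rw [← IsSmooth.partialDeriv_sum_mul ha (fun l => b l y) j x, ← partialDeriv_ker]
    simp only [← h]
    unfold partialDeriv
    congr 1
    ext s
    congr 1; abel
  · have := IsSmooth.partialDeriv_sum_mul hb (fun l => a l x) j y
    simp only [mul_comm (b _ _), mul_comm (partialDeriv _ (b _) _)] at this
    rw [← this]
    simp only [h]

/-- In separated form the mollification is a finite combination of the smooth `a l`, with the
numbers `∫ f b_l` as coefficients. -/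
lemma mollify_isSmooth {f : Torus → ℝ} (hf : Integrable f) (n : ℕ) : IsSmooth (mollify n f) ∧
    ∀ j x, partialDeriv j (mollify n f) x = ∫ y, f y * dker n j (x - y) := by
  obtain ⟨N, a, b, ha, hb, h, hd, -⟩ := exists_ker_sub_eq n
  have key : ∀ c : Fin N → ℝ, ∫ y, f y * ∑ l, c l * b l y = ∑ l, c l * ∫ y, f y * b l y := by
    intro c
    simp only [Finset.mul_sum, ← integral_const_mul, mul_left_comm (f _)]
    exact integral_finsetSum _ fun l _ => (hf.mul_continuous (hb l).continuous).const_mul _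
  have h1 : mollify n f = fun x => ∑ l, a l x * ∫ y, f y * b l y := by
    ext x
    simp only [mollify, h, key (fun l => a l x)]
  rw [h1]
  refine ⟨IsSmooth.sum fun l _ => (ha l).mul (isSmooth_const _), fun j x => ?_⟩
  rw [IsSmooth.partialDeriv_sum_mul ha]
  simp only [hd, key (fun l => partialDeriv j (a l) x)]

/-- The functions `a` and `b` are chosen before `v` and `f`, so for time-dependent data only the
scalar coefficients vary in time. -/
lemma exists_flux_eq (n : ℕ) : ∃ (N : ℕ) (a b : Fin N → Torus → ℝ), (∀ l, IsSmooth (a l)) ∧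
    (∀ l, IsSmooth (b l)) ∧ ∀ (v : Torus → Fin 2 → ℝ) (f : Torus → ℝ),
    (∀ j, Integrable fun x => f x * v x j) →
      ∀ x, flux n v f x = ∑ l, a l x * ∫ y, f y * ∑ j, v y j * partialDeriv j (b l) y := by
  obtain ⟨N, a, b, ha, hb, h, -, hd⟩ := exists_ker_sub_eq n
  refine ⟨N, a, b, ha, hb, fun v f hf x => ?_⟩
  simp only [flux, hd, ← integral_const_mul]
  rw [← integral_finsetSum]
  · congr 1; ext y
    simp only [Finset.mul_sum]
    rw [Finset.sum_comm]
    refine Finset.sum_congr rfl fun l _ => Finset.sum_congr rfl fun j _ => ?_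
    ring
  · intro l _
    simp only [Finset.mul_sum, ← mul_assoc]
    refine integrable_finsetSum _ fun j _ => ?_
    have := ((hf j).mul_continuous ((hb l).partialDeriv j).continuous).const_mul (a l x)
    simpa only [mul_assoc] using this

lemma continuous_flux {v : Torus → Fin 2 → ℝ} {f : Torus → ℝ}
    (hf : ∀ j, Integrable fun x => f x * v x j) (n : ℕ) : Continuous (flux n v f) := by
  obtain ⟨N, a, b, ha, hb, h⟩ := exists_flux_eq n
  rw [show flux n v f = _ from funext (h v f hf)]
  exact continuous_finsetSum _ fun l _ => (ha l).continuous.mul continuous_const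

/-! ### Squared increments averaged against a kernel, and convergence of mollifications -/

lemma measurePreserving_sub : MeasurePreserving (fun p : Torus × Torus => p.1 - p.2)
    (volume.prod volume) volume :=
  measurePreserving_fst.comp (measurePreserving_sub_prod volume volume)

lemma memLp_diff {f : Torus → ℝ} (hf : MemLp f 2) :
    MemLp (fun p : Torus × Torus => f (p.1 - p.2) - f p.1) 2 (volume.prod volume) :=
  (hf.comp_measurePreserving measurePreserving_sub).sub
    (hf.comp_measurePreserving measurePreserving_fst)

lemma integrable_kernel_mul_diff_sq {f : Torus → ℝ} (hf : MemLp f 2) {k : Torus → ℝ}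
    (hk : Continuous k) :
    Integrable (fun p : Torus × Torus => k p.2 * (f (p.1 - p.2) - f p.1) ^ 2)
      (volume.prod volume) := by
  obtain ⟨C, hC⟩ := isCompact_univ.exists_bound_of_continuousOn hk.continuousOn
  exact (memLp_diff hf).integrable_sq.bdd_mul (c := C)
    (hk.comp continuous_snd).aestronglyMeasurable (ae_of_all _ fun p => hC p.2 trivial)

lemma integral_kernel_mul_diff_sq {f : Torus → ℝ} (hf : MemLp f 2) {k : Torus → ℝ}
    (hk : Continuous k) :
    ∫ x, ∫ z, k z * (f (x - z) - f x) ^ 2 = ∫ z, k z * modulus f z := by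
  rw [integral_integral_swap (integrable_kernel_mul_diff_sq hf hk)]
  simp only [integral_const_mul, modulus]

lemma integrable_kernel_mul_modulus {f : Torus → ℝ} (hf : MemLp f 2) {k : Torus → ℝ}
    (hk : Continuous k) : Integrable fun z => k z * modulus f z := by
  have := (integrable_kernel_mul_diff_sq hf hk).integral_prod_right
  simpa only [integral_const_mul, modulus] using this

lemma integral_kernel_mul_modulus_le {f : Torus → ℝ} (hf : MemLp f 2) {k : Torus → ℝ}
    (hk : Continuous k) (hk0 : ∀ z, 0 ≤ k z) {ε C : ℝ}
    (h : ∀ z, modulus f z ≤ ε + C * wgt z) :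
    ∫ z, k z * modulus f z ≤ ε * (∫ z, k z) + C * ∫ z, k z * wgt z := by
  have hw := continuous_wgt
  rw [← integral_const_mul, ← integral_const_mul, ← integral_add]
  · refine integral_mono (integrable_kernel_mul_modulus hf hk)
      (Torus.integrable_of_continuous (by fun_prop)) fun z => ?_
    have := mul_le_mul_of_nonneg_left (h z) (hk0 z)
    simp only
    linarith
  · exact Torus.integrable_of_continuous (by fun_prop)
  · exact Torus.integrable_of_continuous (by fun_prop)

lemma modulus_nonneg (f : Torus → ℝ) (z : Torus) : 0 ≤ modulus f z :=
  integral_nonneg fun _ => sq_nonneg _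

lemma modulus_le {f : Torus → ℝ} (hf : MemLp f 2) (z : Torus) :
    modulus f z ≤ 4 * ∫ x, f x ^ 2 := by
  have h1 : ∫ x, f (x - z) ^ 2 = ∫ x, f x ^ 2 :=
    integral_sub_right_eq_self (fun x => f x ^ 2) z
  have h2 : 4 * ∫ x, f x ^ 2 = ∫ x, (2 * f (x - z) ^ 2 + 2 * f x ^ 2) := by
    rw [integral_add ((memLp_comp_sub hf z).integrable_sq.const_mul 2)
      (hf.integrable_sq.const_mul 2), integral_const_mul, integral_const_mul, h1]
    ring
  rw [h2]
  refine integral_mono ((memLp_comp_sub hf z).sub hf).integrable_sq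
    (((memLp_comp_sub hf z).integrable_sq.const_mul 2).add (hf.integrable_sq.const_mul 2))
    fun x => ?_
  simp only
  nlinarith [sq_nonneg (f (x - z) + f x)]

lemma tendsto_integral_sker_mul_modulus {f : Torus → ℝ} (hf : MemLp f 2) (j : Fin 2) :
    Tendsto (fun n => ∫ z, sker n j z * modulus f z) atTop (𝓝 0) := by
  rw [Metric.tendsto_atTop]
  intro ε hε
  have hpi := Real.pi_pos
  -- The mass of `sker` is at most `4π²`, so this choice makes the first term at most `ε / 2`; the
  -- `wgt` term is `O(1/n)`.
  obtain ⟨C, hC0, hC⟩ := exists_modulus_le hf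
    (show 0 < ε / (2 * (4 * Real.pi ^ 2)) by positivity)
  obtain ⟨N, hN⟩ := exists_nat_gt (C * (4 * Real.pi ^ 2 * 16) / (ε / 2))
  refine ⟨N, fun n hn => ?_⟩
  have h0 : 0 ≤ ∫ z, sker n j z * modulus f z :=
    integral_nonneg fun z => mul_nonneg (sker_nonneg n j z) (modulus_nonneg f z)
  rw [Real.dist_eq, sub_zero, abs_of_nonneg h0]
  refine (integral_kernel_mul_modulus_le hf (continuous_sker n j) (sker_nonneg n j) hC).trans_lt ?_
  rw [integral_sker, integral_sker_mul_wgt]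
  have hnN : (N : ℝ) ≤ n := by exact_mod_cast hn
  rw [div_lt_iff₀ (by positivity)] at hN
  have hn0 : (0 : ℝ) ≤ n := Nat.cast_nonneg n
  have h1 : 4 * Real.pi ^ 2 * (n + 1) / (2 * n + 1) ≤ 4 * Real.pi ^ 2 := by
    rw [div_le_iff₀ (by positivity)]
    nlinarith [sq_nonneg Real.pi]
  have h2 : ε / (2 * (4 * Real.pi ^ 2)) * (4 * Real.pi ^ 2 * (n + 1) / (2 * n + 1)) ≤ ε / 2 := by
    calc _ ≤ ε / (2 * (4 * Real.pi ^ 2)) * (4 * Real.pi ^ 2) := by gcongr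
      _ = ε / 2 := by field_simp
  have h3 : C * (4 * Real.pi ^ 2 * (n + 1) * (16 / ((2 * n + 1) * (2 * n + 4)))) ≤
      C * (4 * Real.pi ^ 2 * 16) / (n + 1) := by
    rw [mul_div_assoc]
    gcongr
    rw [mul_div_assoc', div_le_div_iff₀ (by positivity) (by positivity)]
    have : (n + 1 : ℝ) * (n + 1) ≤ (2 * n + 1) * (2 * n + 4) := by nlinarith
    have := mul_le_mul_of_nonneg_left this (show 0 ≤ 4 * Real.pi ^ 2 * 16 by positivity)
    linarith
  have h4 : C * (4 * Real.pi ^ 2 * 16) / (n + 1) < ε / 2 := by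
    rw [div_lt_iff₀ (by positivity)]
    nlinarith
  linarith

lemma integral_sker_mul_modulus_le {f : Torus → ℝ} (hf : MemLp f 2) (n : ℕ) (j : Fin 2) :
    ∫ z, sker n j z * modulus f z ≤ 16 * Real.pi ^ 2 * ∫ x, f x ^ 2 := by
  refine (integral_kernel_mul_modulus_le hf (continuous_sker n j) (sker_nonneg n j)
    (ε := 4 * ∫ x, f x ^ 2) (C := 0) fun z => by simpa using modulus_le hf z).trans ?_
  rw [integral_sker, zero_mul, add_zero]
  have h0 : 0 ≤ ∫ x, f x ^ 2 := integral_nonneg fun _ => sq_nonneg _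
  have hn0 : (0 : ℝ) ≤ n := Nat.cast_nonneg n
  have h1 : 4 * Real.pi ^ 2 * (n + 1) / (2 * n + 1) ≤ 4 * Real.pi ^ 2 := by
    rw [div_le_iff₀ (by positivity)]
    nlinarith [sq_nonneg Real.pi]
  have := mul_le_mul_of_nonneg_left h1 h0
  linarith

lemma tendsto_integral_ker_mul_modulus {f : Torus → ℝ} (hf : MemLp f 2) :
    Tendsto (fun n => ∫ z, ker n z * modulus f z) atTop (𝓝 0) := by
  rw [Metric.tendsto_atTop]
  intro ε hε
  obtain ⟨C, hC0, hC⟩ := exists_modulus_le hf (show 0 < ε / 2 by positivity)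
  obtain ⟨N, hN⟩ := exists_nat_gt (C * 4 / (ε / 2))
  refine ⟨N, fun n hn => ?_⟩
  have h0 : 0 ≤ ∫ z, ker n z * modulus f z :=
    integral_nonneg fun z => mul_nonneg (ker_nonneg n z) (modulus_nonneg f z)
  rw [Real.dist_eq, sub_zero, abs_of_nonneg h0]
  refine (integral_kernel_mul_modulus_le hf (continuous_ker n) (ker_nonneg n) hC).trans_lt ?_
  rw [integral_ker, integral_ker_mul_wgt]
  have hnN : (N : ℝ) ≤ n := by exact_mod_cast hn
  rw [div_lt_iff₀ (by positivity)] at hN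
  have h4 : C * (8 / (2 * n + 4)) < ε / 2 := by
    rw [mul_div_assoc', div_lt_iff₀ (by positivity)]
    nlinarith
  linarith

lemma mollify_sub_eq {f : Torus → ℝ} (hf : Integrable f) (n : ℕ) (x : Torus) :
    mollify n f x - f x = ∫ z, ker n z * (f (x - z) - f x) := by
  have h1 : mollify n f x = ∫ z, ker n z * f (x - z) := by
    have := integral_sub_left_eq_self (fun y => f y * ker n (x - y)) volume x
    simp only [sub_sub_cancel] at this
    rw [mollify, ← this]
    simp only [mul_comm]
  have h2 : Integrable fun z => ker n z * f (x - z) := by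
    have := (hf.comp_sub_left x).mul_continuous (continuous_ker n)
    simpa only [mul_comm] using this
  simp only [mul_sub]
  rw [integral_sub h2 ((Torus.integrable_of_continuous (continuous_ker n)).mul_const _),
    integral_mul_const, integral_ker, h1, one_mul]

/-- The weighted arithmetic–geometric inequality for `s b²` and `t a²`, whose product is `(a b d)²`.
-/
lemma abs_mul_mul_le {a b c d s t : ℝ} (hc : 0 < c) (hs : 0 ≤ s) (ht : 0 ≤ t)
    (hd : d ^ 2 = s * t) : |a * b * d| ≤ (1 / 2) * (c * (s * b ^ 2) + c⁻¹ * (t * a ^ 2)) := by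
  have hc' : 0 < c⁻¹ := inv_pos.2 hc
  refine abs_le_of_sq_le_sq ?_ (by positivity)
  have h : (a * b * d) ^ 2 = (c * (s * b ^ 2)) * (c⁻¹ * (t * a ^ 2)) := by
    rw [mul_pow, hd]; field_simp
  rw [h]
  nlinarith [sq_nonneg (c * (s * b ^ 2) - c⁻¹ * (t * a ^ 2))]

lemma integral_abs_le_integral_prod {r : Torus → ℝ} {k : Torus → Torus → ℝ}
    {H : Torus × Torus → ℝ} (hr : Integrable r) (hH : Integrable H (volume.prod volume))
    (hrk : ∀ x, r x = ∫ z, k x z) (hk : ∀ x z, |k x z| ≤ H (x, z)) :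
    ∫ x, |r x| ≤ ∫ p, H p ∂(volume.prod volume) := by
  rw [integral_prod _ hH]
  refine integral_mono_ae hr.abs hH.integral_prod_left ?_
  filter_upwards [hH.prod_right_ae] with x hx
  rw [hrk, ← Real.norm_eq_abs]
  exact norm_integral_le_of_norm_le hx (ae_of_all _ fun z => (Real.norm_eq_abs _).trans_le (hk x z))

lemma integral_prod_kernel_mul_diff_sq {f : Torus → ℝ} (hf : MemLp f 2) {k : Torus → ℝ}
    (hk : Continuous k) :
    ∫ p : Torus × Torus, k p.2 * (f (p.1 - p.2) - f p.1) ^ 2 ∂(volume.prod volume) =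
      ∫ z, k z * modulus f z := by
  rw [integral_prod _ (integrable_kernel_mul_diff_sq hf hk)]
  exact integral_kernel_mul_diff_sq hf hk

lemma integral_abs_mollify_sub_le {f : Torus → ℝ} (hf : MemLp f 2) (n : ℕ) {c : ℝ} (hc : 0 < c) :
    ∫ x, |mollify n f x - f x| ≤ (1 / 2) * (c + c⁻¹ * ∫ z, ker n z * modulus f z) := by
  have hfi : Integrable f := hf.integrable (by simp)
  have hi := integrable_kernel_mul_diff_sq hf (continuous_ker n)
  have hk : Integrable (fun p : Torus × Torus => ker n p.2) (volume.prod volume) :=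
    measurePreserving_snd.integrable_comp_of_integrable
      (Torus.integrable_of_continuous (continuous_ker n))
  have hk1 : ∫ p : Torus × Torus, ker n p.2 ∂(volume.prod volume) = 1 := by
    rw [integral_prod _ hk]; simp [integral_ker]
  refine (integral_abs_le_integral_prod (k := fun x z => ker n z * (f (x - z) - f x))
    (H := fun p => (1 / 2) * (c * ker n p.2 + c⁻¹ * (ker n p.2 * (f (p.1 - p.2) - f p.1) ^ 2)))
    ((Torus.integrable_of_continuous (mollify_isSmooth hfi n).1.continuous).sub hfi)
    (((hk.const_mul c).add (hi.const_mul c⁻¹)).const_mul _) (mollify_sub_eq hfi n)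
    fun x z => ?_).trans_eq ?_
  · have := abs_mul_mul_le (a := f (x - z) - f x) (b := 1) hc (ker_nonneg n z) (ker_nonneg n z)
      (sq _)
    simpa [mul_comm (ker n z)] using this
  · rw [integral_const_mul, integral_add (hk.const_mul c) (hi.const_mul c⁻¹), integral_const_mul,
      integral_const_mul, hk1, mul_one, integral_prod_kernel_mul_diff_sq hf (continuous_ker n)]

/-- First fix `c` small, then let the index run. Keeping `c` free in the inequality plays the role
of Cauchy–Schwarz. -/
lemma tendsto_of_forall_le {ι : Type*} {e s : ι → ℝ} {l : Filter ι} {A : ℝ}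
    (hs : Tendsto s l (𝓝 0)) (hs0 : ∀ n, 0 ≤ s n)
    (h : ∀ n (c : ℝ), 0 < c → |e n| ≤ A * c + c⁻¹ * s n) : Tendsto e l (𝓝 0) := by
  rw [tendsto_zero_iff_abs_tendsto_zero]
  rw [Metric.tendsto_nhds] at hs ⊢
  intro ε hε
  set c : ℝ := ε / (2 * (|A| + 1)) with hc
  have hc0 : 0 < c := by positivity
  filter_upwards [hs (c * (ε / 2)) (by positivity)] with n hn
  rw [Real.dist_eq, sub_zero, abs_of_nonneg (hs0 n)] at hn
  rw [Real.dist_eq, sub_zero, Function.comp, abs_abs]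
  refine (h n c hc0).trans_lt ?_
  have h1 : c⁻¹ * s n < ε / 2 := by
    rw [inv_mul_lt_iff₀ hc0]; exact hn
  have h2 : A * c ≤ ε / 2 := by
    calc A * c ≤ (|A| + 1) * c := by
          gcongr; linarith [le_abs_self A]
      _ = ε / 2 := by rw [hc]; field_simp
  linarith

lemma tendsto_integral_abs_mollify_sub {f : Torus → ℝ} (hf : MemLp f 2) :
    Tendsto (fun n => ∫ x, |mollify n f x - f x|) atTop (𝓝 0) := by
  refine tendsto_of_forall_le (A := 1 / 2) (tendsto_integral_ker_mul_modulus hf)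
    (fun n => integral_nonneg fun z => mul_nonneg (ker_nonneg n z) (modulus_nonneg f z))
    fun n c hc => ?_
  rw [abs_of_nonneg (integral_nonneg fun x => abs_nonneg _)]
  refine (integral_abs_mollify_sub_le hf n hc).trans ?_
  have : 0 ≤ c⁻¹ * ∫ z, ker n z * modulus f z := mul_nonneg (inv_pos.2 hc).le
    (integral_nonneg fun z => mul_nonneg (ker_nonneg n z) (modulus_nonneg f z))
  linarith

/-- The kernel is a probability density, so an average of `f` obeys the same bound. -/
lemma abs_mollify_le {f : Torus → ℝ} {M : ℝ} (hM : ∀ᵐ x, |f x| ≤ M) (n : ℕ) (x : Torus) :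
    |mollify n f x| ≤ M := by
  have hk : Integrable fun y => ker n (x - y) :=
    (Torus.integrable_of_continuous (continuous_ker n)).comp_sub_left x
  have h1 : ∫ y, M * ker n (x - y) = M := by
    rw [integral_const_mul, integral_sub_left_eq_self (ker n) volume x, integral_ker, mul_one]
  rw [← h1, ← Real.norm_eq_abs]
  refine norm_integral_le_of_norm_le (hk.const_mul M) ?_
  filter_upwards [hM] with y hy
  rw [norm_mul, Real.norm_eq_abs, Real.norm_eq_abs, abs_of_nonneg (ker_nonneg n _)]
  exact mul_le_mul_of_nonneg_right hy (ker_nonneg n _)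

/-- The commutator of mollification and transport by `v`. -/
def commutator (n : ℕ) (v : Torus → Fin 2 → ℝ) (f : Torus → ℝ) (x : Torus) : ℝ :=
  flux n v f x + ∑ j, v x j * partialDeriv j (mollify n f) x

/-- Expanding the product of differences gives the commutator and two further terms. One vanishes
because `dker` has mean zero, the other because `v` is divergence free, tested on the translated
kernel. -/
lemma commutator_eq {B : ℝ} {v : Torus → Fin 2 → ℝ} (hv : IsSobolevField B v) {f : Torus → ℝ}
    (hf : MemLp f 2) (n : ℕ) (x : Torus) :
    commutator n v f x =
      ∫ z, ∑ j, (f (x - z) - f x) * (v x j - v (x - z) j) * dker n j z := by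
  have hfi : Integrable f := hf.integrable (by simp)
  have hfv : ∀ j, Integrable fun y => f y * v y j := fun j => hf.integrable_mul (hv.memLp j)
  have hvi : ∀ j, Integrable fun y => v y j := fun j => (hv.memLp j).integrable (by simp)
  have hdc : ∀ j, Continuous fun y => dker n j (x - y) := fun j =>
    (continuous_dker n j).comp (continuous_const.sub continuous_id)
  have hdi : ∀ j, Integrable fun y => dker n j (x - y) := fun j =>
    Torus.integrable_of_continuous (hdc j)
  have hd0 : ∀ j, ∫ y, dker n j (x - y) = 0 := fun j => by
    rw [integral_sub_left_eq_self (dker n j) volume x, integral_dker]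
  have hdiv := hv.div_free _ ((isSmooth_ker n).comp_sub_left x)
  simp only [partialDeriv_ker_comp_sub] at hdiv
  have h1 := integral_sub_left_eq_self
    (fun y => ∑ j, (f y - f x) * (v x j - v y j) * dker n j (x - y)) volume x
  simp only [sub_sub_cancel] at h1
  rw [h1]
  have i1 : Integrable fun y => f y * ∑ j, v y j * -dker n j (x - y) := by
    simp only [Finset.mul_sum, ← mul_assoc]
    exact integrable_finsetSum _ fun j _ => (hfv j).mul_continuous (hdc j).neg
  have i2 : ∀ j, Integrable fun y => v x j * (f y * dker n j (x - y)) := fun j =>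
    (hfi.mul_continuous (hdc j)).const_mul _
  have i3 : ∀ j, Integrable fun y => f x * v x j * dker n j (x - y) := fun j =>
    (hdi j).const_mul _
  have i4 : Integrable fun y => f x * ∑ j, v y j * -dker n j (x - y) := by
    refine Integrable.const_mul ?_ _
    exact integrable_finsetSum _ fun j _ => (hvi j).mul_continuous (hdc j).neg
  have h2 : ∀ y, ∑ j, (f y - f x) * (v x j - v y j) * dker n j (x - y) =
      (f y * ∑ j, v y j * -dker n j (x - y)) + (∑ j, v x j * (f y * dker n j (x - y))) -
      (∑ j, f x * v x j * dker n j (x - y)) - f x * ∑ j, v y j * -dker n j (x - y) := by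
    intro y
    simp only [Fin.sum_univ_two]
    ring
  simp only [h2]
  rw [integral_sub, integral_sub, integral_add i1 (integrable_finsetSum _ fun j _ => i2 j),
    integral_finsetSum _ fun j _ => i2 j, integral_finsetSum _ fun j _ => i3 j]
  · simp only [integral_const_mul, hd0, hdiv, mul_zero, Finset.sum_const_zero, sub_zero]
    simp only [commutator, flux, partialDeriv_ker_comp_sub, (mollify_isSmooth hfi n).2]
  · exact i1.add (integrable_finsetSum _ fun j _ => i2 j)
  · exact integrable_finsetSum _ fun j _ => i3 j
  · exact (i1.add (integrable_finsetSum _ fun j _ => i2 j)).sub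
      (integrable_finsetSum _ fun j _ => i3 j)
  · exact i4

lemma integrable_transport {B : ℝ} {v : Torus → Fin 2 → ℝ} (hv : IsSobolevField B v)
    {η : Torus → ℝ} (hη : IsSmooth η) :
    Integrable fun x => ∑ j, v x j * partialDeriv j η x :=
  integrable_finsetSum _ fun j _ =>
    ((hv.memLp j).integrable (by simp)).mul_continuous (hη.partialDeriv j).continuous

lemma integrable_commutator {B : ℝ} {v : Torus → Fin 2 → ℝ} (hv : IsSobolevField B v)
    {f : Torus → ℝ} (hf : MemLp f 2) (n : ℕ) : Integrable (commutator n v f) :=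
  (Torus.integrable_of_continuous (continuous_flux
    (fun j => hf.integrable_mul (hv.memLp j)) n)).add
    (integrable_transport hv (mollify_isSmooth (hf.integrable (by simp)) n).1)

/-- Apply `abs_mul_mul_le` to the factorization `dker_sq`: the weight `(n + 1) ker` goes to the
increments of `v`, and `sker` to those of `f`. -/
lemma integral_abs_commutator_le {B : ℝ} {v : Torus → Fin 2 → ℝ} (hv : IsSobolevField B v)
    {f : Torus → ℝ} (hf : MemLp f 2) (n : ℕ) {c : ℝ} (hc : 0 < c) :
    ∫ x, |commutator n v f x| ≤
      4 * B * c + c⁻¹ * ∑ j, (1 / 2) * ∫ z, sker n j z * modulus f z := by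
  have hX : Continuous fun z => ((n : ℝ) + 1) * ker n z := continuous_const.mul (continuous_ker n)
  have i1 := fun j => integrable_kernel_mul_diff_sq (hv.memLp j) hX
  have i2 := fun j => integrable_kernel_mul_diff_sq hf (continuous_sker n j)
  have i3 : ∀ j, Integrable (fun p : Torus × Torus => (1 / 2) *
      (c * (((n + 1) * ker n p.2) * (v (p.1 - p.2) j - v p.1 j) ^ 2) +
      c⁻¹ * (sker n j p.2 * (f (p.1 - p.2) - f p.1) ^ 2))) (volume.prod volume) := fun j =>
    (((i1 j).const_mul c).add ((i2 j).const_mul c⁻¹)).const_mul _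
  -- The second moment of `ker` exactly balances the factor `n + 1`. After the factor `1 / 2`, each
  -- of the two coordinates contributes `2 * B * c`.
  have hB : ∀ j, ∫ z, ((n + 1) * ker n z) * modulus (fun x => v x j) z ≤ 4 * B := by
    intro j
    have h0 : 0 ≤ B := (integral_nonneg fun _ => sq_nonneg _).trans (hv.integral_sq_le j)
    refine (integral_kernel_mul_modulus_le (hv.memLp j) hX
      (fun z => mul_nonneg (by positivity) (ker_nonneg n z)) (ε := 0) (C := B)
      (fun z => by simpa using hv.modulus_le j z)).trans ?_
    simp only [mul_assoc]
    rw [integral_const_mul ((n : ℝ) + 1) fun z => ker n z * wgt z, integral_ker_mul_wgt, zero_mul,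
      zero_add]
    have : ((n : ℝ) + 1) * (8 / (2 * n + 4)) ≤ 4 := by
      rw [mul_div_assoc', div_le_iff₀ (by positivity)]
      linarith
    nlinarith
  refine (integral_abs_le_integral_prod
    (k := fun x z => ∑ j, (f (x - z) - f x) * (v x j - v (x - z) j) * dker n j z)
    (H := fun p => ∑ j, (1 / 2) * (c * (((n + 1) * ker n p.2) * (v (p.1 - p.2) j - v p.1 j) ^ 2) +
      c⁻¹ * (sker n j p.2 * (f (p.1 - p.2) - f p.1) ^ 2)))
    (integrable_commutator hv hf n) (integrable_finsetSum _ fun j _ => i3 j)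
    (commutator_eq hv hf n) fun x z => ?_).trans ?_
  · refine (Finset.abs_sum_le_sum_abs _ _).trans (Finset.sum_le_sum fun j _ => ?_)
    have := abs_mul_mul_le (a := f (x - z) - f x) (b := v x j - v (x - z) j) hc
      (mul_nonneg (by positivity : (0 : ℝ) ≤ n + 1) (ker_nonneg n z)) (sker_nonneg n j z)
      (dker_sq n j z)
    rwa [← sub_sq_comm (v (x - z) j)] at this
  · rw [integral_finsetSum _ fun j _ => i3 j]
    have h1 : ∀ j, ∫ p : Torus × Torus, (1 / 2) *
        (c * (((n + 1) * ker n p.2) * (v (p.1 - p.2) j - v p.1 j) ^ 2) +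
        c⁻¹ * (sker n j p.2 * (f (p.1 - p.2) - f p.1) ^ 2)) ∂(volume.prod volume) ≤
        2 * B * c + c⁻¹ * ((1 / 2) * ∫ z, sker n j z * modulus f z) := by
      intro j
      rw [integral_const_mul, integral_add ((i1 j).const_mul c) ((i2 j).const_mul c⁻¹),
        integral_const_mul, integral_const_mul,
        integral_prod_kernel_mul_diff_sq (hv.memLp j) hX,
        integral_prod_kernel_mul_diff_sq hf (continuous_sker n j)]
      have := mul_le_mul_of_nonneg_left (hB j) hc.le
      linarith
    refine (Finset.sum_le_sum fun j _ => h1 j).trans_eq ?_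
    simp only [Fin.sum_univ_two]
    ring

/-- The choice `c = 1` gives a bound independent of `n`, which serves as the dominating constant for
the limit in time. -/
lemma integral_abs_commutator_le_const {B : ℝ} {v : Torus → Fin 2 → ℝ} (hv : IsSobolevField B v)
    {f : Torus → ℝ} (hf : MemLp f 2) (n : ℕ) :
    ∫ x, |commutator n v f x| ≤ 4 * B + 16 * Real.pi ^ 2 * ∫ x, f x ^ 2 := by
  refine (integral_abs_commutator_le hv hf n one_pos).trans ?_
  have h0 := integral_sker_mul_modulus_le hf n 0
  have h1 := integral_sker_mul_modulus_le hf n 1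
  rw [Fin.sum_univ_two]
  linarith

lemma tendsto_integral_abs_commutator {B : ℝ} {v : Torus → Fin 2 → ℝ} (hv : IsSobolevField B v)
    {f : Torus → ℝ} (hf : MemLp f 2) :
    Tendsto (fun n => ∫ x, |commutator n v f x|) atTop (𝓝 0) := by
  refine tendsto_of_forall_le (A := 4 * B)
    (s := fun n => ∑ j, (1 / 2) * ∫ z, sker n j z * modulus f z) ?_ (fun n => ?_)
    fun n c hc => ?_
  · have := tendsto_finsetSum Finset.univ fun j _ =>
      (tendsto_integral_sker_mul_modulus hf j).const_mul (1 / 2)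
    simpa using this
  · exact Finset.sum_nonneg fun j _ => mul_nonneg (by norm_num)
      (integral_nonneg fun z => mul_nonneg (sker_nonneg n j z) (modulus_nonneg f z))
  · rw [abs_of_nonneg (integral_nonneg fun x => abs_nonneg _)]
    exact integral_abs_commutator_le hv hf n hc

variable {ι : Type*} [Fintype ι]

/-- The rate of change of `∫ G (mollify n f)` under transport by `v`. -/
def energyRate (G : (ι → ℝ) → ℝ) (n : ℕ) (v : Torus → Fin 2 → ℝ) (f : ι → Torus → ℝ) : ℝ :=
  ∫ x, fderiv ℝ G (fun i => mollify n (f i) x) fun i => flux n v (f i) x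

/-- Since `v` is divergence free, `∫ v · ∇(G(fₙ)) = 0` can be added; by the chain rule it turns each
flux into a commutator. The mollifications stay in the ball where `L` bounds the derivative of `G`.
-/
lemma abs_energyRate_le {G : (ι → ℝ) → ℝ} (hG : ContDiff ℝ (⊤ : ℕ∞) G) {M L : ℝ} (hM0 : 0 ≤ M)
    (hL : ∀ y, ‖y‖ ≤ M → ‖fderiv ℝ G y‖ ≤ L) {B : ℝ} {v : Torus → Fin 2 → ℝ}
    (hv : IsSobolevField B v) {f : ι → Torus → ℝ} (hf : ∀ i, MemLp (f i) 2)
    (hM : ∀ i, ∀ᵐ x, |f i x| ≤ M) (n : ℕ) :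
    |energyRate G n v f| ≤ L * ∑ i, ∫ x, |commutator n v (f i) x| := by
  have hfi : ∀ i, Integrable (f i) := fun i => (hf i).integrable (by simp)
  have hs := fun i => (mollify_isSmooth (hfi i) n).1
  have hGs : IsSmooth fun x => G fun i => mollify n (f i) x := IsSmooth.comp_contDiff hG hs
  have hdiv := hv.div_free _ hGs
  have hFc : Continuous fun x => fun i => mollify n (f i) x :=
    continuous_pi fun i => (hs i).continuous
  have hdG : Continuous fun x => fderiv ℝ G (fun i => mollify n (f i) x) :=
    (hG.continuous_fderiv (by simp)).comp hFc
  have hfl : Continuous fun x => fun i => flux n v (f i) x :=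
    continuous_pi fun i => continuous_flux (fun j => (hf i).integrable_mul (hv.memLp j)) n
  have i1 : Integrable fun x => fderiv ℝ G (fun i => mollify n (f i) x)
      fun i => flux n v (f i) x := Torus.integrable_of_continuous (hdG.clm_apply hfl)
  have h1 : energyRate G n v f = ∫ x, fderiv ℝ G (fun i => mollify n (f i) x)
      fun i => commutator n v (f i) x := by
    rw [energyRate, ← add_zero (∫ x, _), ← hdiv, ← integral_add i1 (integrable_transport hv hGs)]
    refine integral_congr_ae (ae_of_all _ fun x => ?_)
    simp only [IsSmooth.partialDeriv_comp hG hs]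
    have : (fun i => commutator n v (f i) x) = (fun i => flux n v (f i) x) +
        ∑ j, v x j • fun i => partialDeriv j (mollify n (f i)) x := by
      ext i
      simp [commutator]
    rw [this, map_add, map_sum]
    simp only [map_smul, smul_eq_mul]
  have i2 : ∀ i, Integrable fun x => |commutator n v (f i) x| := fun i =>
    (integrable_commutator hv (hf i) n).abs
  rw [h1, ← integral_finsetSum _ fun i _ => i2 i, ← integral_const_mul, ← Real.norm_eq_abs]
  refine norm_integral_le_of_norm_le ((integrable_finsetSum _ fun i _ => i2 i).const_mul L)
    (ae_of_all _ fun x => ?_)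
  have hb : ‖fun i => mollify n (f i) x‖ ≤ M :=
    (pi_norm_le_iff_of_nonneg hM0).2 fun i => abs_mollify_le (hM i) n x
  have hc : ‖fun i => commutator n v (f i) x‖ ≤ ∑ i, |commutator n v (f i) x| :=
    (pi_norm_le_iff_of_nonneg (Finset.sum_nonneg fun i _ => abs_nonneg _)).2 fun i =>
      Finset.single_le_sum (f := fun i => |commutator n v (f i) x|) (fun i _ => abs_nonneg _)
        (Finset.mem_univ i)
  refine (ContinuousLinearMap.le_opNorm _ _).trans ?_
  exact mul_le_mul (hL _ hb) hc (norm_nonneg _) ((norm_nonneg _).trans (hL _ hb))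

lemma tendsto_energyRate {G : (ι → ℝ) → ℝ} (hG : ContDiff ℝ (⊤ : ℕ∞) G) {M L : ℝ} (hM0 : 0 ≤ M)
    (hL : ∀ y, ‖y‖ ≤ M → ‖fderiv ℝ G y‖ ≤ L) {B : ℝ} {v : Torus → Fin 2 → ℝ}
    (hv : IsSobolevField B v) {f : ι → Torus → ℝ} (hf : ∀ i, MemLp (f i) 2)
    (hM : ∀ i, ∀ᵐ x, |f i x| ≤ M) :
    Tendsto (fun n => energyRate G n v f) atTop (𝓝 0) := by
  refine squeeze_zero_norm (abs_energyRate_le hG hM0 hL hv hf hM) ?_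
  have := (tendsto_finsetSum Finset.univ fun i _ =>
    tendsto_integral_abs_commutator hv (hf i)).const_mul L
  simpa using this

lemma exists_bound_fderiv {G : (ι → ℝ) → ℝ} (hG : ContDiff ℝ (⊤ : ℕ∞) G) (M : ℝ) :
    ∃ L, 0 ≤ L ∧ ∀ y, ‖y‖ ≤ M → ‖fderiv ℝ G y‖ ≤ L := by
  obtain ⟨L, hL⟩ := (isCompact_closedBall (0 : ι → ℝ) M).exists_bound_of_continuousOn
    (hG.continuous_fderiv (by simp)).continuousOn
  exact ⟨max L 0, le_max_right _ _, fun y hy =>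
    (hL y (by simpa using hy)).trans (le_max_left _ _)⟩

lemma abs_sub_le_of_bound_fderiv {G : (ι → ℝ) → ℝ} (hG : ContDiff ℝ (⊤ : ℕ∞) G) {M L : ℝ}
    (hL : ∀ y, ‖y‖ ≤ M → ‖fderiv ℝ G y‖ ≤ L) {y z : ι → ℝ} (hy : ‖y‖ ≤ M) (hz : ‖z‖ ≤ M) :
    |G y - G z| ≤ L * ‖y - z‖ :=
  (convex_closedBall (0 : ι → ℝ) M).norm_image_sub_le_of_norm_fderiv_le
    (fun x _ => hG.differentiable (by simp) x) (fun x hx => hL x (by simpa using hx))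
    (by simpa using hz) (by simpa using hy)

lemma integrable_comp_of_ae_le {G : (ι → ℝ) → ℝ} (hG : ContDiff ℝ (⊤ : ℕ∞) G) {M : ℝ}
    (hM0 : 0 ≤ M) {f : ι → Torus → ℝ} (hfm : ∀ i, AEStronglyMeasurable (f i))
    (hM : ∀ i, ∀ᵐ x, |f i x| ≤ M) : Integrable fun x => G fun i => f i x := by
  obtain ⟨L, hL0, hL⟩ := exists_bound_fderiv hG M
  have hb : ∀ᵐ x, ‖G fun i => f i x‖ ≤ |G 0| + L * M := by
    filter_upwards [ae_all_iff.2 hM] with x hx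
    have hx : ‖fun i => f i x‖ ≤ M := (pi_norm_le_iff_of_nonneg hM0).2 hx
    have h1 := abs_sub_le_of_bound_fderiv hG hL hx (z := 0) (by simpa using hM0)
    rw [sub_zero] at h1
    have h2 := abs_sub_abs_le_abs_sub (G fun i => f i x) (G 0)
    have h3 := mul_le_mul_of_nonneg_left hx hL0
    rw [Real.norm_eq_abs]
    linarith
  refine Integrable.of_bound ?_ _ hb
  refine hG.continuous.comp_aestronglyMeasurable ?_
  exact (aemeasurable_pi_lambda _ fun i => (hfm i).aemeasurable).aestronglyMeasurable

/-- On the ball of radius `M`, which contains the values of `f` and of its mollifications, `G` is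
Lipschitz; so `L¹` convergence of the mollifications suffices. -/
lemma tendsto_integral_comp_mollify {G : (ι → ℝ) → ℝ} (hG : ContDiff ℝ (⊤ : ℕ∞) G) {M : ℝ}
    (hM0 : 0 ≤ M) {f : ι → Torus → ℝ} (hfm : ∀ i, AEStronglyMeasurable (f i))
    (hM : ∀ i, ∀ᵐ x, |f i x| ≤ M) :
    Tendsto (fun n => ∫ x, G fun i => mollify n (f i) x) atTop (𝓝 (∫ x, G fun i => f i x)) := by
  obtain ⟨L, hL0, hL⟩ := exists_bound_fderiv hG M
  have hf : ∀ i, MemLp (f i) 2 := fun i => MemLp.of_bound (hfm i) M (hM i)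
  have hfi : ∀ i, Integrable (f i) := fun i => (hf i).integrable (by simp)
  have hs := fun n i => (mollify_isSmooth (hfi i) n).1
  have hae : ∀ᵐ x, ‖fun i => f i x‖ ≤ M := by
    filter_upwards [ae_all_iff.2 hM] with x hx
    exact (pi_norm_le_iff_of_nonneg hM0).2 hx
  have hm : ∀ n x, ‖fun i => mollify n (f i) x‖ ≤ M := fun n x =>
    (pi_norm_le_iff_of_nonneg hM0).2 fun i => abs_mollify_le (hM i) n x
  have i1 : ∀ n, Integrable fun x => G fun i => mollify n (f i) x := fun n =>
    Torus.integrable_of_continuous (IsSmooth.comp_contDiff hG (hs n)).continuous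
  have i2 := integrable_comp_of_ae_le hG hM0 hfm hM
  rw [← tendsto_sub_nhds_zero_iff]
  have h := (tendsto_finsetSum Finset.univ fun i _ =>
    tendsto_integral_abs_mollify_sub (hf i)).const_mul L
  simp only [Finset.sum_const_zero, mul_zero] at h
  refine squeeze_zero_norm (fun n => ?_) h
  have i3 : ∀ i, Integrable fun x => |mollify n (f i) x - f i x| := fun i =>
    ((Torus.integrable_of_continuous (hs n i).continuous).sub (hfi i)).abs
  rw [← integral_sub (i1 n) i2, ← integral_finsetSum _ fun i _ => i3 i, ← integral_const_mul]
  refine norm_integral_le_of_norm_le ((integrable_finsetSum _ fun i _ => i3 i).const_mul L) ?_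
  filter_upwards [hae] with x hx
  refine (abs_sub_le_of_bound_fderiv hG hL (hm n x) hx).trans ?_
  refine mul_le_mul_of_nonneg_left ?_ hL0
  exact (pi_norm_le_iff_of_nonneg (Finset.sum_nonneg fun i _ => abs_nonneg _)).2 fun i =>
    Finset.single_le_sum (f := fun i => |mollify n (f i) x - f i x|) (fun i _ => abs_nonneg _)
      (Finset.mem_univ i)

end

end SoftmaxEuler

namespace SoftmaxEuler

open MeasureTheory

/-! ### Evolution in time -/

noncomputable section

open Filter Topology

variable {ι : Type*} [Fintype ι]

lemma exists_mollify_eq (n : ℕ) : ∃ (N : ℕ) (a b : Fin N → Torus → ℝ), (∀ l, IsSmooth (a l)) ∧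
    (∀ l, IsSmooth (b l)) ∧ ∀ f : Torus → ℝ, Integrable f →
      ∀ x, mollify n f x = ∑ l, a l x * ∫ y, f y * b l y := by
  obtain ⟨N, a, b, ha, hb, h, -, -⟩ := exists_ker_sub_eq n
  refine ⟨N, a, b, ha, hb, fun f hf x => ?_⟩
  simp only [mollify, h, Finset.mul_sum, ← integral_const_mul, mul_left_comm (f _)]
  exact integral_finsetSum _ fun l _ => (hf.mul_continuous (hb l).continuous).const_mul _

/-- For fixed `n` the constant depends on neither `v` nor `f`, so the flux is bounded uniformly in
time and space. -/
lemma exists_abs_flux_le (n : ℕ) : ∃ C, 0 ≤ C ∧ ∀ {B : ℝ} {v : Torus → Fin 2 → ℝ}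
    {f : Torus → ℝ}, IsSobolevField B v → MemLp f 2 →
      ∀ x, |flux n v f x| ≤ C * ((∫ y, f y ^ 2) + B) := by
  have hC : ∀ j, ∃ C, ∀ z, |dker n j z| ≤ C := fun j => by
    obtain ⟨C, hC⟩ := isCompact_univ.exists_bound_of_continuousOn (continuous_dker n j).continuousOn
    exact ⟨C, fun z => hC z trivial⟩
  choose C hC using hC
  have hC0 : ∀ j, 0 ≤ C j := fun j => (abs_nonneg _).trans (hC j 0)
  refine ⟨∑ j, C j, Finset.sum_nonneg fun j _ => hC0 j, fun {B v f} hv hf x => ?_⟩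
  have i1 : ∀ j, Integrable fun y => C j * ((1 / 2) * (f y ^ 2 + v y j ^ 2)) := fun j =>
    ((hf.integrable_sq.add (hv.memLp j).integrable_sq).const_mul _).const_mul _
  have h1 : ∀ j, ∫ y, C j * ((1 / 2) * (f y ^ 2 + v y j ^ 2)) ≤
      C j * ((∫ y, f y ^ 2) + B) := by
    intro j
    rw [integral_const_mul, integral_const_mul,
      integral_add hf.integrable_sq (hv.memLp j).integrable_sq]
    refine mul_le_mul_of_nonneg_left ?_ (hC0 j)
    have := hv.integral_sq_le j
    have h0 : 0 ≤ ∫ y, f y ^ 2 := integral_nonneg fun _ => sq_nonneg _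
    have h2 : 0 ≤ ∫ y, v y j ^ 2 := integral_nonneg fun _ => sq_nonneg _
    linarith
  rw [Finset.sum_mul]
  refine le_trans ?_ (Finset.sum_le_sum fun j _ => h1 j)
  rw [← integral_finsetSum _ fun j _ => i1 j, ← Real.norm_eq_abs]
  refine norm_integral_le_of_norm_le (integrable_finsetSum _ fun j _ => i1 j)
    (ae_of_all _ fun y => ?_)
  rw [Finset.mul_sum]
  refine (norm_sum_le _ _).trans (Finset.sum_le_sum fun j _ => ?_)
  rw [partialDeriv_ker_comp_sub, Real.norm_eq_abs, ← mul_assoc, abs_mul, abs_neg, mul_comm]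
  have h3 : |f y * v y j| ≤ (1 / 2) * (f y ^ 2 + v y j ^ 2) := by
    refine abs_le.2 ⟨?_, ?_⟩ <;> nlinarith [sq_nonneg (f y + v y j), sq_nonneg (f y - v y j)]
  exact mul_le_mul (hC j _) h3 (abs_nonneg _) (hC0 j)

/-- A primitive of a bounded function is Lipschitz, and so is its composition with `G`. The
fundamental theorem for absolutely continuous functions applies, with the chain rule at almost every
time. -/
lemma comp_sub_comp_eq_integral {G : (ι → ℝ) → ℝ} (hG : ContDiff ℝ (⊤ : ℕ∞) G) {t C : ℝ}
    (ht : 0 ≤ t) {h : ι → ℝ → ℝ}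
    (hm : ∀ i, AEStronglyMeasurable (h i) (volume.restrict (Set.Icc 0 t)))
    (hC : ∀ i, ∀ s ∈ Set.Icc 0 t, |h i s| ≤ C) {F : ι → ℝ → ℝ}
    (hF : ∀ i, ∀ s ∈ Set.Icc 0 t, F i s = F i 0 + ∫ r in (0 : ℝ)..s, h i r) :
    G (fun i => F i t) - G (fun i => F i 0) =
      ∫ s in Set.Icc 0 t, fderiv ℝ G (fun i => F i s) fun i => h i s := by
  have hion : ∀ i, IntegrableOn (h i) (Set.Icc 0 t) := fun i =>
    Integrable.of_bound (hm i) C ((ae_restrict_iff' measurableSet_Icc).2 (ae_of_all _ (hC i)))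
  have hint : ∀ i, IntervalIntegrable (h i) volume 0 t := fun i =>
    (intervalIntegrable_iff_integrableOn_Icc_of_le ht).2 (hion i)
  -- `F` is known only on `[0, t]`; the primitive `P` agrees with it there and can be differentiated
  -- without regard to the endpoints.
  set P : ι → ℝ → ℝ := fun i s => F i 0 + ∫ r in (0 : ℝ)..s, h i r with hP
  have hPF : ∀ s ∈ Set.Icc 0 t, (fun i => P i s) = fun i => F i s := fun s hs =>
    funext fun i => (hF i s hs).symm
  have hC' : ∀ i, ∀ s ∈ Set.Icc 0 t, |h i s| ≤ |C| := fun i s hs =>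
    (hC i s hs).trans (le_abs_self C)
  have hlip : ∀ a ∈ Set.Icc 0 t, ∀ b ∈ Set.Icc 0 t,
      ‖(fun i => P i a) - fun i => P i b‖ ≤ |C| * |a - b| := by
    intro a ha b hb
    refine (pi_norm_le_iff_of_nonneg (by positivity)).2 fun i => ?_
    have h1 : P i a - P i b = ∫ r in b..a, h i r := by
      simp only [hP]
      rw [add_sub_add_left_eq_sub, intervalIntegral.integral_interval_sub_left]
      · exact (hint i).mono_set (by
          rw [Set.uIcc_of_le ha.1, Set.uIcc_of_le ht]; exact Set.Icc_subset_Icc_right ha.2)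
      · exact (hint i).mono_set (by
          rw [Set.uIcc_of_le hb.1, Set.uIcc_of_le ht]; exact Set.Icc_subset_Icc_right hb.2)
    simp only [Pi.sub_apply]
    rw [h1]
    refine intervalIntegral.norm_integral_le_of_norm_le_const fun r hr => ?_
    refine hC' i r ?_
    have := Set.uIoc_subset_uIcc hr
    exact Set.uIcc_subset_Icc hb ha this
  have h0 : (0 : ℝ) ∈ Set.Icc 0 t := ⟨le_rfl, ht⟩
  have htt : t ∈ Set.Icc 0 t := ⟨ht, le_rfl⟩
  set R : ℝ := ‖fun i => P i 0‖ + |C| * t with hR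
  have hball : ∀ a ∈ Set.Icc 0 t, ‖fun i => P i a‖ ≤ R := by
    intro a ha
    have h1 := hlip a ha 0 h0
    have h2 : ‖fun i => P i a‖ ≤ ‖(fun i => P i a) - fun i => P i 0‖ + ‖fun i => P i 0‖ := by
      simpa using norm_add_le ((fun i => P i a) - fun i => P i 0) (fun i => P i 0)
    rw [sub_zero, abs_of_nonneg ha.1] at h1
    have h3 := mul_le_mul_of_nonneg_left ha.2 (abs_nonneg C)
    linarith
  obtain ⟨L, hL0, hL⟩ := exists_bound_fderiv hG R
  have hac : AbsolutelyContinuousOnInterval (fun s => G fun i => P i s) 0 t := by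
    refine LipschitzOnWith.absolutelyContinuousOnInterval (K := (L * |C|).toNNReal) ?_
    rw [Set.uIcc_of_le ht]
    refine LipschitzOnWith.of_dist_le_mul fun a ha b hb => ?_
    rw [Real.coe_toNNReal _ (by positivity), Real.dist_eq, Real.dist_eq, mul_assoc]
    exact (abs_sub_le_of_bound_fderiv hG hL (hball a ha) (hball b hb)).trans
      (mul_le_mul_of_nonneg_left (hlip a ha b hb) hL0)
  have hd := hac.integral_deriv_eq_sub
  rw [← hPF t htt, ← hPF 0 h0, ← hd, intervalIntegral.integral_of_le ht,
    ← integral_Icc_eq_integral_Ioc]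
  refine setIntegral_congr_ae measurableSet_Icc ?_
  filter_upwards [ae_all_iff.2 fun i => (hint i).ae_hasDerivAt_integral] with s hs hst
  have hsu : s ∈ Set.uIcc 0 t := by rwa [Set.uIcc_of_le ht]
  have h1 : HasDerivAt (fun s => fun i => P i s) (fun i => h i s) s :=
    hasDerivAt_pi.2 fun i => (hs i hsu 0 (by simp)).const_add _
  have h2 : HasFDerivAt G (fderiv ℝ G fun i => P i s) (fun i => P i s) :=
    (hG.differentiable (by simp) _).hasFDerivAt
  rw [← hPF s hst]
  exact (h2.comp_hasDerivAt s h1).deriv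

variable {u : ℝ → Torus → Fin 2 → ℝ} {f : ι → ℝ → Torus → ℝ} {f₀ : ι → Torus → ℝ} {T : EReal}

lemma aestronglyMeasurable_integral_mul {t : ℝ} {g : ℝ → Torus → ℝ}
    (hg : AEStronglyMeasurable (fun p : ℝ × Torus => g p.1 p.2)
      ((volume.restrict (Set.Icc 0 t)).prod volume)) {b : Torus → ℝ} (hb : Continuous b) :
    AEStronglyMeasurable (fun s => ∫ y, g s y * b y) (volume.restrict (Set.Icc 0 t)) :=
  (hg.mul (hb.comp continuous_snd).aestronglyMeasurable).integral_prod_right'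

lemma aestronglyMeasurable_integral_transport {t : ℝ} {g : ℝ → Torus → ℝ}
    (hg : AEStronglyMeasurable (fun p : ℝ × Torus => g p.1 p.2)
      ((volume.restrict (Set.Icc 0 t)).prod volume))
    (hu : ∀ j, AEStronglyMeasurable (fun p : ℝ × Torus => u p.1 p.2 j)
      ((volume.restrict (Set.Icc 0 t)).prod volume)) {b : Torus → ℝ} (hb : IsSmooth b) :
    AEStronglyMeasurable (fun s => ∫ y, g s y * ∑ j, u s y j * partialDeriv j b y)
      (volume.restrict (Set.Icc 0 t)) := by
  have : AEStronglyMeasurable (fun p : ℝ × Torus => ∑ j, u p.1 p.2 j * partialDeriv j b p.2)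
      ((volume.restrict (Set.Icc 0 t)).prod volume) :=
    Finset.aestronglyMeasurable_fun_sum _ fun j _ =>
      (hu j).mul ((hb.partialDeriv j).continuous.comp continuous_snd).aestronglyMeasurable
  exact (hg.mul this).integral_prod_right'

lemma ae_restrict_prod_of_forall {t : ℝ} {P : ℝ × Torus → Prop}
    (h : ∀ s ∈ Set.Icc 0 t, ∀ x, P (s, x)) :
    ∀ᵐ p ∂((volume.restrict (Set.Icc 0 t)).prod (volume : Measure Torus)), P p := by
  have h1 : ∀ᵐ s ∂(volume.restrict (Set.Icc 0 t)), ∀ x, P (s, x) :=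
    (ae_restrict_iff' measurableSet_Icc).2 (ae_of_all _ h)
  filter_upwards [Measure.quasiMeasurePreserving_fst.ae h1] with p hp
  exact hp p.2

/-- The weak formulation with the time-independent test function `y ↦ ker n (x - y)`. -/
lemma mollify_of_isTransported {u : ℝ → Torus → Fin 2 → ℝ} {g : ℝ → Torus → ℝ}
    {g₀ : Torus → ℝ} (hg : IsTransported T u g₀ g) (n : ℕ) (x : Torus) {t : ℝ}
    (ht : t ∈ times T) :
    mollify n (g t) x = mollify n g₀ x + ∫ s in (0 : ℝ)..t, flux n (u s) (g s) x := by
  have := hg.2 _ ((isSmooth_ker n).comp_sub_left x).isSmoothInTime t ht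
  simpa only [deriv_const, zero_add, mollify, flux] using this

lemma times_of_le {s t : ℝ} (ht : t ∈ times T) (hs : s ∈ Set.Icc 0 t) : s ∈ times T :=
  ⟨hs.1, le_trans (by exact_mod_cast hs.2) ht.2⟩

lemma integral_sq_le_of_ae_le {g : Torus → ℝ} {M : ℝ}
    (hM : ∀ᵐ x, |g x| ≤ M) : ∫ x, g x ^ 2 ≤ M ^ 2 := by
  have h := norm_integral_le_of_norm_le_const (μ := (volume : Measure Torus))
    (f := fun x => g x ^ 2) (C := M ^ 2) (by
      filter_upwards [hM] with x hx
      rw [Real.norm_eq_abs, abs_pow]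
      gcongr)
  have h2 := (le_abs_self _).trans h
  simpa using h2

/-- At each fixed `x` the mollified scalars solve an integral equation in time, so the chain rule
applies pointwise; Fubini then exchanges space and time. -/
lemma integral_comp_mollify_sub_eq {G : (ι → ℝ) → ℝ} (hG : ContDiff ℝ (⊤ : ℕ∞) G) {t B M : ℝ}
    (ht : t ∈ times T) (hM0 : 0 ≤ M)
    (hu : ∀ j, AEStronglyMeasurable (fun p : ℝ × Torus => u p.1 p.2 j)
      ((volume.restrict (Set.Icc 0 t)).prod volume))
    (hv : ∀ s ∈ Set.Icc 0 t, IsSobolevField B (u s))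
    (hf : ∀ i, IsTransported T u (f₀ i) (f i))
    (hf₀ : ∀ i, Integrable (f₀ i))
    (hM : ∀ i, ∀ s ∈ Set.Icc 0 t, ∀ᵐ x, |f i s x| ≤ M) (n : ℕ) :
    Integrable (fun s => energyRate G n (u s) fun i => f i s) (volume.restrict (Set.Icc 0 t)) ∧
    (∫ x, G fun i => mollify n (f i t) x) - (∫ x, G fun i => mollify n (f₀ i) x) =
      ∫ s in Set.Icc 0 t, energyRate G n (u s) fun i => f i s := by
  have htt : t ∈ Set.Icc 0 t := ⟨ht.1, le_rfl⟩
  have h0 : (0 : ℝ) ∈ Set.Icc 0 t := ⟨le_rfl, ht.1⟩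
  have hf2 : ∀ i, ∀ s ∈ Set.Icc 0 t, MemLp (f i s) 2 := fun i s hs =>
    MemLp.of_bound ((hf i).1.1 s (times_of_le ht hs)) M (hM i s hs)
  have hfi : ∀ i, ∀ s ∈ Set.Icc 0 t, Integrable (f i s) := fun i s hs =>
    (hf2 i s hs).integrable (by simp)
  have hfv : ∀ i, ∀ s ∈ Set.Icc 0 t, ∀ j, Integrable fun x => f i s x * u s x j :=
    fun i s hs j => (hf2 i s hs).integrable_mul ((hv s hs).memLp j)
  have hfm : ∀ i, AEStronglyMeasurable (fun p : ℝ × Torus => f i p.1 p.2)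
      ((volume.restrict (Set.Icc 0 t)).prod volume) := fun i => ((hf i).1.2 t ht).1
  obtain ⟨N, a, b, ha, hb, hab⟩ := exists_mollify_eq n
  obtain ⟨N', a', b', ha', hb', hab'⟩ := exists_flux_eq n
  obtain ⟨C, hC0, hC⟩ := exists_abs_flux_le n
  have hflux : ∀ i, ∀ s ∈ Set.Icc 0 t, ∀ x, |flux n (u s) (f i s) x| ≤ C * (M ^ 2 + B) := by
    intro i s hs x
    refine (hC (hv s hs) (hf2 i s hs) x).trans ?_
    have := integral_sq_le_of_ae_le (hM i s hs)
    gcongr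
  have hmeas : ∀ i l, AEStronglyMeasurable
      (fun s => ∫ y, f i s y * ∑ j, u s y j * partialDeriv j (b' l) y)
      (volume.restrict (Set.Icc 0 t)) := fun i l =>
    aestronglyMeasurable_integral_transport (hfm i) hu (hb' l)
  have hmollify : ∀ i, ∀ s ∈ Set.Icc 0 t, ∀ x,
      mollify n (f i s) x = mollify n (f i 0) x + ∫ r in (0 : ℝ)..s, flux n (u r) (f i r) x := by
    intro i s hs x
    rw [mollify_of_isTransported (hf i) n x (times_of_le ht hs),
      mollify_of_isTransported (hf i) n x (times_of_le ht h0)]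
    simp
  -- The weak formulation at time zero identifies the mollifications of `f i 0` and `f₀ i`;
  -- pointwise equality is not needed.
  have hinit : ∀ i x, mollify n (f i 0) x = mollify n (f₀ i) x := by
    intro i x
    rw [mollify_of_isTransported (hf i) n x (times_of_le ht h0)]
    simp
  have hpt : ∀ x, G (fun i => mollify n (f i t) x) - G (fun i => mollify n (f₀ i) x) =
      ∫ s in Set.Icc 0 t, fderiv ℝ G (fun i => mollify n (f i s) x)
        fun i => flux n (u s) (f i s) x := by
    intro x
    simp only [← hinit]
    refine comp_sub_comp_eq_integral hG ht.1 (F := fun i s => mollify n (f i s) x)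
      (h := fun i s => flux n (u s) (f i s) x) (fun i => ?_)
      (fun i s hs => hflux i s hs x) (fun i s hs => hmollify i s hs x)
    have h1 : AEStronglyMeasurable (fun s => ∑ l, a' l x *
        ∫ y, f i s y * ∑ j, u s y j * partialDeriv j (b' l) y)
        (volume.restrict (Set.Icc 0 t)) :=
      Finset.aestronglyMeasurable_fun_sum _ fun l _ => (hmeas i l).const_mul _
    refine h1.congr ?_
    refine (ae_restrict_iff' measurableSet_Icc).2 (ae_of_all _ fun s hs => ?_)
    exact (hab' _ _ (hfv i s hs) x).symm
  have hm1 : ∀ i, AEMeasurable (fun p : ℝ × Torus => mollify n (f i p.1) p.2)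
      ((volume.restrict (Set.Icc 0 t)).prod volume) := by
    intro i
    have h1 : AEStronglyMeasurable (fun p : ℝ × Torus => ∑ l, a l p.2 * ∫ y, f i p.1 y * b l y)
        ((volume.restrict (Set.Icc 0 t)).prod volume) :=
      Finset.aestronglyMeasurable_fun_sum _ fun l _ =>
        ((ha l).continuous.comp continuous_snd).aestronglyMeasurable.mul
          (aestronglyMeasurable_integral_mul (hfm i) (hb l).continuous).comp_fst
    refine (h1.congr ?_).aemeasurable
    exact ae_restrict_prod_of_forall fun s hs x => (hab _ (hfi i s hs) x).symm
  have hm2 : ∀ i, AEMeasurable (fun p : ℝ × Torus => flux n (u p.1) (f i p.1) p.2)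
      ((volume.restrict (Set.Icc 0 t)).prod volume) := by
    intro i
    have h1 : AEStronglyMeasurable (fun p : ℝ × Torus => ∑ l, a' l p.2 *
        ∫ y, f i p.1 y * ∑ j, u p.1 y j * partialDeriv j (b' l) y)
        ((volume.restrict (Set.Icc 0 t)).prod volume) :=
      Finset.aestronglyMeasurable_fun_sum _ fun l _ =>
        ((ha' l).continuous.comp continuous_snd).aestronglyMeasurable.mul (hmeas i l).comp_fst
    refine (h1.congr ?_).aemeasurable
    exact ae_restrict_prod_of_forall fun s hs x => (hab' _ _ (hfv i s hs) x).symm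
  obtain ⟨L, hL0, hL⟩ := exists_bound_fderiv hG M
  have hB0 : 0 ≤ B := (integral_nonneg fun _ => sq_nonneg _).trans ((hv 0 h0).integral_sq_le 0)
  have hint : Integrable (fun p : ℝ × Torus => fderiv ℝ G (fun i => mollify n (f i p.1) p.2)
      fun i => flux n (u p.1) (f i p.1) p.2) ((volume.restrict (Set.Icc 0 t)).prod volume) := by
    refine Integrable.of_bound (C := L * (C * (M ^ 2 + B))) ?_ ?_
    · have hc : Continuous fun q : (ι → ℝ) × (ι → ℝ) => fderiv ℝ G q.1 q.2 :=
        ((hG.continuous_fderiv (by simp)).comp continuous_fst).clm_apply continuous_snd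
      exact hc.comp_aestronglyMeasurable ((aemeasurable_pi_lambda _ hm1).prodMk
        (aemeasurable_pi_lambda _ hm2)).aestronglyMeasurable
    · refine ae_restrict_prod_of_forall fun s hs x => ?_
      refine (ContinuousLinearMap.le_opNorm _ _).trans ?_
      refine mul_le_mul (hL _ ?_) ?_ (norm_nonneg _) hL0
      · exact (pi_norm_le_iff_of_nonneg hM0).2 fun i => abs_mollify_le (hM i s hs) n x
      · exact (pi_norm_le_iff_of_nonneg (by positivity)).2 fun i => hflux i s hs x
  refine ⟨hint.integral_prod_left, ?_⟩
  rw [← integral_sub]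
  · simp only [hpt, energyRate]
    exact (integral_integral_swap hint).symm
  · exact Torus.integrable_of_continuous (IsSmooth.comp_contDiff hG fun i =>
      (mollify_isSmooth (hfi i t htt) n).1).continuous
  · exact Torus.integrable_of_continuous (IsSmooth.comp_contDiff hG fun i =>
      (mollify_isSmooth (hf₀ i) n).1).continuous

/-- Let `n → ∞` in the mollified balance: the left side tends to the difference of the two
integrals, and the right side to zero by dominated convergence in time. -/
theorem integral_comp_eq_of_isTransported {G : (ι → ℝ) → ℝ} (hG : ContDiff ℝ (⊤ : ℕ∞) G)
    {t B M : ℝ} (ht : t ∈ times T) (hM0 : 0 ≤ M)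
    (hu : ∀ j, AEStronglyMeasurable (fun p : ℝ × Torus => u p.1 p.2 j)
      ((volume.restrict (Set.Icc 0 t)).prod volume))
    (hv : ∀ s ∈ Set.Icc 0 t, IsSobolevField B (u s))
    (hf : ∀ i, IsTransported T u (f₀ i) (f i))
    (hf₀ : ∀ i, AEStronglyMeasurable (f₀ i)) (hM₀ : ∀ i, ∀ᵐ x, |f₀ i x| ≤ M)
    (hM : ∀ i, ∀ s ∈ Set.Icc 0 t, ∀ᵐ x, |f i s x| ≤ M) :
    ∫ x, G (fun i => f i t x) = ∫ x, G fun i => f₀ i x := by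
  have htt : t ∈ Set.Icc 0 t := ⟨ht.1, le_rfl⟩
  have hf2 : ∀ i, ∀ s ∈ Set.Icc 0 t, MemLp (f i s) 2 := fun i s hs =>
    MemLp.of_bound ((hf i).1.1 s (times_of_le ht hs)) M (hM i s hs)
  have key := integral_comp_mollify_sub_eq hG ht hM0 hu hv hf
    (fun i => Integrable.of_bound (hf₀ i) M (hM₀ i)) hM
  have h1 := (tendsto_integral_comp_mollify hG hM0
    (fun i => (hf i).1.1 t ht) (fun i => hM i t htt)).sub
    (tendsto_integral_comp_mollify hG hM0 hf₀ hM₀)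
  simp only [(key _).2] at h1
  obtain ⟨L, hL0, hL⟩ := exists_bound_fderiv hG M
  have h2 : Tendsto (fun n => ∫ s in Set.Icc 0 t, energyRate G n (u s) fun i => f i s) atTop
      (𝓝 (∫ s in Set.Icc 0 t, 0)) := by
    refine tendsto_integral_of_dominated_convergence
      (fun _ => L * ∑ _i : ι, (4 * B + 16 * Real.pi ^ 2 * M ^ 2)) (fun n => (key n).1.1)
      (integrable_const _) (fun n => ?_) ?_
    · refine (ae_restrict_iff' measurableSet_Icc).2 (ae_of_all _ fun s hs => ?_)
      refine (abs_energyRate_le hG hM0 hL (hv s hs) (fun i => hf2 i s hs)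
        (fun i => hM i s hs) n).trans ?_
      gcongr with i
      refine (integral_abs_commutator_le_const (hv s hs) (hf2 i s hs) n).trans ?_
      have := integral_sq_le_of_ae_le (hM i s hs)
      gcongr
    · refine (ae_restrict_iff' measurableSet_Icc).2 (ae_of_all _ fun s hs => ?_)
      exact tendsto_energyRate hG hM0 hL (hv s hs) (fun i => hf2 i s hs) (fun i => hM i s hs)
  have h3 := tendsto_nhds_unique h1 h2
  simp only [integral_zero] at h3
  exact sub_eq_zero.1 h3

/-! ### The softmax mixture -/

lemma contDiff_softmaxWeight {K : ℕ} (β : ℝ) (k : Fin K) :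
    ContDiff ℝ (⊤ : ℕ∞) fun a : Fin K → ℝ => softmaxWeight β a k := by
  unfold softmaxWeight
  have h : ∀ j : Fin K, ContDiff ℝ (⊤ : ℕ∞) fun a : Fin K → ℝ => Real.exp (β * a j) := fun j =>
    (contDiff_const.mul (contDiff_apply ℝ ℝ j)).exp
  refine (h k).div (ContDiff.sum fun j _ => h j) fun a => ?_
  exact (Finset.sum_pos (fun j _ => Real.exp_pos _) ⟨k, Finset.mem_univ k⟩).ne'

lemma IsC1Holder.continuous {α : ℝ} {g : Torus → ℝ} (h : IsC1Holder α g) : Continuous g :=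
  continuous_of_comp_proj h.1.continuous

/-- The squared distance of the last coordinate from the softmax mixture of the others. -/
def softmaxDefect {K : ℕ} (β : ℝ) (c : Fin K → ℝ) (y : Option (Fin K) → ℝ) : ℝ :=
  (y none - ∑ k, c k * softmaxWeight β (fun j => y (some j)) k) ^ 2

lemma softmaxDefect_nonneg {K : ℕ} (β : ℝ) (c : Fin K → ℝ) (y : Option (Fin K) → ℝ) :
    0 ≤ softmaxDefect β c y := sq_nonneg _

lemma contDiff_softmaxDefect {K : ℕ} (β : ℝ) (c : Fin K → ℝ) :
    ContDiff ℝ (⊤ : ℕ∞) (softmaxDefect β c) := by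
  unfold softmaxDefect
  refine ContDiff.pow (ContDiff.sub (contDiff_apply ℝ ℝ _) ?_) 2
  refine ContDiff.sum fun k _ => contDiff_const.mul ?_
  exact (contDiff_softmaxWeight β k).comp (contDiff_pi.2 fun j => contDiff_apply ℝ ℝ _)

lemma continuous_sum_softmaxWeight {K : ℕ} (β : ℝ) (c : Fin K → ℝ) {g : Fin K → Torus → ℝ}
    (hg : ∀ k, Continuous (g k)) :
    Continuous fun x => ∑ k, c k * softmaxWeight β (fun j => g j x) k :=
  continuous_finsetSum _ fun k _ => continuous_const.mul
    ((contDiff_softmaxWeight β k).continuous.comp (continuous_pi hg))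

lemma exists_ae_abs_le_of_continuous {g : Torus → ℝ} (hg : Continuous g) :
    ∃ M, ∀ᵐ x, |g x| ≤ M := by
  obtain ⟨M, hM⟩ := isCompact_univ.exists_bound_of_continuousOn hg.continuousOn
  exact ⟨M, ae_of_all _ fun x => hM x trivial⟩

end

end SoftmaxEuler

/-! ### Conservation of the softmax defect -/

theorem mainTheorem6 (K : ℕ) (hK : 2 ≤ K) (α : ℝ) (hα : α ∈ Set.Ioo (0 : ℝ) 1)
    (β : ℝ) (hβ : 0 < β) (c : Fin K → ℝ)
    (φin : Fin K → SoftmaxEuler.Torus → ℝ) (hφin : ∀ k, SoftmaxEuler.IsC1Holder α (φin k))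
    (T : EReal) (hT : 0 < T)
    (ω : ℝ → SoftmaxEuler.Torus → ℝ) (u : ℝ → SoftmaxEuler.Torus → Fin 2 → ℝ)
    (hω : SoftmaxEuler.IsYudovichSolution T (SoftmaxEuler.softmaxMixture β c φin) ω u)
    (φ : Fin K → ℝ → SoftmaxEuler.Torus → ℝ)
    (hφ : ∀ k, SoftmaxEuler.IsTransported T u (φin k) (φ k)) :
    ∀ t ∈ SoftmaxEuler.times T,
      (∀ᵐ x : SoftmaxEuler.Torus,
        ω t x = ∑ k, c k * SoftmaxEuler.softmaxWeight β (fun j => φ j t x) k) ∧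
      (Continuous (ω t) → (∀ k, Continuous (φ k t)) →
        ∀ x : SoftmaxEuler.Torus,
          ω t x = ∑ k, c k * SoftmaxEuler.softmaxWeight β (fun j => φ j t x) k) := by
  intro t ht
  -- Continuous functions that agree almost everywhere agree everywhere, since nonempty open sets
  -- have positive measure.
  suffices h : ∀ᵐ x : SoftmaxEuler.Torus,
      ω t x = ∑ k, c k * SoftmaxEuler.softmaxWeight β (fun j => φ j t x) k from
    ⟨h, fun h1 h2 x => congrFun
      ((h1.ae_eq_iff_eq MeasureTheory.volume (SoftmaxEuler.continuous_sum_softmaxWeight β c h2)).1 h) x⟩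
  -- The index `none` carries the vorticity and `some k` the markers, so that a single function `G`
  -- sees them jointly.
  let f : Option (Fin K) → ℝ → SoftmaxEuler.Torus → ℝ := fun i => i.elim ω φ
  let f₀ : Option (Fin K) → SoftmaxEuler.Torus → ℝ := fun i =>
    i.elim (SoftmaxEuler.softmaxMixture β c φin) φin
  have hf : ∀ i, SoftmaxEuler.IsTransported T u (f₀ i) (f i) := by
    rintro (_ | k)
    · exact hω.transport
    · exact hφ k
  have hf₀ : ∀ i, Continuous (f₀ i) := by
    rintro (_ | k)
    · exact SoftmaxEuler.continuous_sum_softmaxWeight β c fun k => (hφin k).continuous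
    · exact (hφin k).continuous
  choose M₁ hM₁ using fun i => SoftmaxEuler.exists_ae_abs_le_of_continuous (hf₀ i)
  choose M₂ hM₂ using fun i => ((hf i).1.2 t ht).2
  -- One bound for all scalars, initially and on `[0, t]`.
  set M : ℝ := ∑ i, (|M₁ i| + |M₂ i|) with hM
  have hle : ∀ i, |M₁ i| + |M₂ i| ≤ M := fun i =>
    Finset.single_le_sum (f := fun i => |M₁ i| + |M₂ i|) (fun i _ => by positivity)
      (Finset.mem_univ i)
  have hM0 : 0 ≤ M := Finset.sum_nonneg fun i _ => by positivity
  have hb₀ : ∀ i, ∀ᵐ x, |f₀ i x| ≤ M := fun i => by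
    filter_upwards [hM₁ i] with x hx
    linarith [hle i, le_abs_self (M₁ i), abs_nonneg (M₂ i)]
  have hb : ∀ i, ∀ s ∈ Set.Icc 0 t, ∀ᵐ x, |f i s x| ≤ M := fun i s hs => by
    filter_upwards [hM₂ i s hs] with x hx
    linarith [hle i, le_abs_self (M₂ i), abs_nonneg (M₁ i)]
  have hv : ∀ s ∈ Set.Icc 0 t, SoftmaxEuler.IsSobolevField (8 * M ^ 2) (u s) := fun s hs =>
    (hω.velocity s (SoftmaxEuler.times_of_le ht hs)).isSobolevField
      ((hf none).1.1 s (SoftmaxEuler.times_of_le ht hs)) (hb none s hs)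
  have hG := SoftmaxEuler.contDiff_softmaxDefect β c
  have key := SoftmaxEuler.integral_comp_eq_of_isTransported hG ht hM0
    (fun j => (hω.velocity_integrable t ht j).1) hv hf
    (fun i => (hf₀ i).aestronglyMeasurable) hb₀ hb
  have hzero : ∫ x, SoftmaxEuler.softmaxDefect β c (fun i => f₀ i x) = 0 := by
    have : ∀ x, SoftmaxEuler.softmaxDefect β c (fun i => f₀ i x) = 0 := fun x => by
      simp [SoftmaxEuler.softmaxDefect, f₀, SoftmaxEuler.softmaxMixture]
    simp [this]
  have htt : t ∈ Set.Icc 0 t := ⟨ht.1, le_rfl⟩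
  rw [hzero, MeasureTheory.integral_eq_zero_iff_of_nonneg (fun x => SoftmaxEuler.softmaxDefect_nonneg β c _)
    (SoftmaxEuler.integrable_comp_of_ae_le hG hM0 (fun i => (hf i).1.1 t ht)
      fun i => hb i t htt)] at key
  filter_upwards [key] with x hx
  exact sub_eq_zero.1 (pow_eq_zero_iff two_ne_zero |>.1 hx)
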